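/- All graphs are finite and simple. A partially labeled graph is a graph in which some of the vertices carry distinct natural numbers as labels; let $\mathcal F$ be the set of partially labeled graphs up to label-preserving isomorphism, and for a finite $L\subset\mathbb N$ let $\mathcal F_L$ be the set of those whose set of labels is exactly $L$. The product $H_1\cdot H_2$ is obtained from the disjoint union by identifying vertices with the same label and keeping one copy of each multiple edge. Let $\mathbb R[\mathcal F]$ be the semigroup algebra, whose elements are called labeled quantum graphs, let $\mathcal K$ be its ideal generated by the elements $F-\emptyset$, where $F$ is a one-vertex graph (labeled or not) and $\emptyset$ is the graph without vertices, and put $\mathcal A=\mathbb R[\mathcal F]/\mathcal K$. Let $\mathcal A_L\subseteq\mathcal A$ be the image of $\mathbb R[\mathcal F_L]$; the elements of $\mathbb R[\mathcal F_\emptyset]$ are the quantum graphs. For $T\subseteq\mathbb N$ let $\llbracket\cdot\rrbracket_T:\mathcal A\to\mathcal A$ be the linear map induced by removing the labels not in $T$ (the vertices remain, unlabeled). For $H\in\mathcal F_L$, a nonempty graph $G$ and a map $\phi$ from a set of labels containing $L$ to $V(G)$, let $t(H;G,\phi)$ be the probability that a uniformly random map $V(H)\to V(G)$, conditioned on sending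 the labeled vertices according to $\phi$, maps every edge of $H$ to an edge of $G$. This extends linearly to $\mathbb R[\mathcal F]$ and is well defined on $\mathcal A$. An element $f\in\mathcal A$ is positive if $t(f;G,\phi)\ge 0$ for all $G$ and $\phi$. The Cauchy–Schwarz calculus operates with statements $f\ge 0$, $f\in\mathcal A$. Its axioms are $f^2\ge 0$ for every $f\in\mathcal A$, and $$\llbracket f_1^2\rrbracket_T\,\llbracket f_2^2\rrbracket_T-\llbracket f_1f_2\rrbracket_T^2\ge 0$$ for finite sets $T\subseteq L\subset\mathbb N$ and $f_1,f_2\in\mathcal A_L$. Its inference rules are: from $f\ge 0$ and $g\ge 0$ infer $\alpha f+\beta g\ge 0$ for all real $\alpha,\beta\ge 0$; from $f\ge 0$ and $g\ge 0$ infer $fg\ge 0$; from $f\ge 0$ infer $\llbracket f\rrbracket_T\ge 0$ for every $T\subseteq\mathbb N$. An element $f\in\mathcal A$ is CS-positive if the statement $f\ge 0$ is provable in this calculus. **Theorem.** There exists a positive $f\in\mathcal A_\emptyset$ that is not CS-positive. -/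

import Mathlib

noncomputable section

open scoped Classical

namespace QuantumGraph

/-- A finite simple graph some of whose vertices carry distinct natural numbers as labels.
Its labeled vertices are the labels themselves, `Sum.inl l` for `l ∈ labels`, and its unlabeled
vertices are `Sum.inr u` for `u : U`.  A point `Sum.inl l` with `l ∉ labels` is not a vertex of
the graph, and no edge touches it. -/
structure PLGraph where
  labels : Finset ℕ
  U : Type
  finite : Finite U
  graph : SimpleGraph (ℕ ⊕ U)
  mem_labels : ∀ l w, graph.Adj (Sum.inl l) w → l ∈ labels

attribute [instance] PLGraph.finite

namespace PLGraph

/-- Label-preserving isomorphism. -/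
def Iso (H₁ H₂ : PLGraph) : Prop :=
  H₁.labels = H₂.labels ∧ ∃ e : H₁.U ≃ H₂.U,
    ∀ a b, H₂.graph.Adj (Sum.map id e a) (Sum.map id e b) ↔ H₁.graph.Adj a b

theorem Iso.of_map {H₁ H₂ : PLGraph} (h : H₁.labels = H₂.labels) (e : H₁.U ≃ H₂.U)
    (he : H₁.graph.map (Sum.map id e) = H₂.graph) : Iso H₁ H₂ := by
  refine ⟨h, e, fun a b => ?_⟩
  have hinj : Function.Injective (Sum.map id e : ℕ ⊕ H₁.U → ℕ ⊕ H₂.U) :=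
    Sum.map_injective.2 ⟨Function.injective_id, e.injective⟩
  rw [← he]
  exact SimpleGraph.map_adj_apply (f := ⟨_, hinj⟩)

theorem Iso.exists_map {H₁ H₂ : PLGraph} (h : Iso H₁ H₂) : H₁.labels = H₂.labels ∧
    ∃ e : H₁.U ≃ H₂.U, H₁.graph.map (Sum.map id e) = H₂.graph := by
  obtain ⟨h, e, he⟩ := h
  refine ⟨h, e, ?_⟩
  have hinj : Function.Injective (Sum.map id e : ℕ ⊕ H₁.U → ℕ ⊕ H₂.U) :=
    Sum.map_injective.2 ⟨Function.injective_id, e.injective⟩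
  have hsurj : Function.Surjective (Sum.map id e : ℕ ⊕ H₁.U → ℕ ⊕ H₂.U) :=
    Sum.map_surjective.2 ⟨Function.surjective_id, e.surjective⟩
  ext x y
  obtain ⟨a, rfl⟩ := hsurj x
  obtain ⟨b, rfl⟩ := hsurj y
  rw [he]
  exact SimpleGraph.map_adj_apply (f := ⟨_, hinj⟩)

theorem Iso.refl (H : PLGraph) : Iso H H := ⟨rfl, Equiv.refl _, by simp⟩

theorem Iso.symm {H₁ H₂ : PLGraph} (h : Iso H₁ H₂) : Iso H₂ H₁ := by
  obtain ⟨h, e, he⟩ := h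
  refine ⟨h.symm, e.symm, fun a b => ?_⟩
  rw [← he]
  simp

theorem Iso.trans {H₁ H₂ H₃ : PLGraph} (h : Iso H₁ H₂) (h' : Iso H₂ H₃) : Iso H₁ H₃ := by
  obtain ⟨h, e, he⟩ := h
  obtain ⟨h', e', he'⟩ := h'
  refine ⟨h.trans h', e.trans e', fun a b => ?_⟩
  rw [← he, ← he']
  simp

instance setoid : Setoid PLGraph := ⟨Iso, Iso.refl, Iso.symm, Iso.trans⟩

theorem map_sup {V W : Type*} (G H : SimpleGraph V) (f : V → W) :
    (G ⊔ H).map f = G.map f ⊔ H.map f := by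
  ext x y
  simp only [SimpleGraph.map_adj', SimpleGraph.sup_adj]
  grind

/-- The product: take the disjoint union, identify vertices with the same label, and keep one
copy of each multiple edge. -/
def mul (H₁ H₂ : PLGraph) : PLGraph where
  labels := H₁.labels ∪ H₂.labels
  U := H₁.U ⊕ H₂.U
  finite := inferInstance
  graph := H₁.graph.map (Sum.map id Sum.inl) ⊔ H₂.graph.map (Sum.map id Sum.inr)
  mem_labels := by
    intro l w h
    have h1 := H₁.mem_labels
    have h2 := H₂.mem_labels
    simp only [SimpleGraph.sup_adj, SimpleGraph.map_adj'] at h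
    rw [Finset.mem_union]
    rcases h with ⟨_, a, b, hab, ha, _⟩ | ⟨_, a, b, hab, ha, _⟩
    · rcases a with a | a
      · simp at ha; subst ha; exact Or.inl (h1 _ _ hab)
      · simp at ha
    · rcases a with a | a
      · simp at ha; subst ha; exact Or.inr (h2 _ _ hab)
      · simp at ha

/-- The graph without vertices. -/
def empty : PLGraph where
  labels := ∅
  U := Empty
  finite := inferInstance
  graph := ⊥
  mem_labels := by simp

/-- The one-vertex graph whose vertex is not labeled. -/
def point : PLGraph where
  labels := ∅
  U := Unit
  finite := inferInstance
  graph := ⊥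
  mem_labels := by simp

/-- The one-vertex graph whose vertex has the label `l`. -/
def labeledPoint (l : ℕ) : PLGraph where
  labels := {l}
  U := Empty
  finite := inferInstance
  graph := ⊥
  mem_labels := by simp

/-- The vertex of the graph with the labels outside `T` removed that comes from a given vertex. -/
def unlabelMap (H : PLGraph) (T : Set ℕ) :
    ℕ ⊕ H.U → ℕ ⊕ (H.U ⊕ {l : ℕ // l ∈ H.labels ∧ l ∉ T})
  | Sum.inl l => if h : l ∈ H.labels ∧ l ∉ T then Sum.inr (Sum.inr ⟨l, h⟩) else Sum.inl l
  | Sum.inr u => Sum.inr (Sum.inl u)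

theorem finite_unlabeled (s : Finset ℕ) (T : Set ℕ) : Finite {l : ℕ // l ∈ s ∧ l ∉ T} :=
  Set.Finite.to_subtype (s := {l | l ∈ s ∧ l ∉ T}) (s.finite_toSet.subset fun _ h => h.1)

/-- Remove the labels that are not in `T`; their vertices stay as unlabeled vertices. -/
def unlabel (T : Set ℕ) (H : PLGraph) : PLGraph where
  labels := H.labels.filter (· ∈ T)
  U := H.U ⊕ {l : ℕ // l ∈ H.labels ∧ l ∉ T}
  finite := by
    have := finite_unlabeled H.labels T
    infer_instance
  graph := H.graph.map (H.unlabelMap T)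
  mem_labels := by
    intro l w h
    rw [SimpleGraph.map_adj'] at h
    obtain ⟨_, a, b, hab, ha, _⟩ := h
    rcases a with a | a
    · have := H.mem_labels _ _ hab
      simp only [unlabelMap] at ha
      split_ifs at ha with h
      simp only [Sum.inl.injEq] at ha
      subst ha
      simp only [Finset.mem_filter]
      tauto
    · simp [unlabelMap] at ha

/-- The homomorphism density `t(H; G, φ)`: the proportion, among all maps of the unlabeled
vertices of `H` to `V(G)`, of those that together with `φ` on the labeled vertices map each edge
of `H` to an edge of `G`.  The values of `φ` at labels that do not occur in `H` play no role. -/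
def density (H : PLGraph) {V : Type} (G : SimpleGraph V) (φ : ℕ → V) : ℝ :=
  (Nat.card {ψ : H.U → V // ∀ a b, H.graph.Adj a b → G.Adj (Sum.elim φ ψ a) (Sum.elim φ ψ b)} : ℝ)
    / (Nat.card V : ℝ) ^ Nat.card H.U

theorem density_congr {H₁ H₂ : PLGraph} (h : Iso H₁ H₂) {V : Type} (G : SimpleGraph V)
    (φ : ℕ → V) : H₁.density G φ = H₂.density G φ := by
  obtain ⟨_, e, he⟩ := h
  unfold density
  rw [Nat.card_congr e]
  congr 2
  refine Nat.card_congr ((Equiv.arrowCongr e (Equiv.refl V)).subtypeEquiv fun ψ => ?_)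
  have key : ∀ a, Sum.elim φ ((Equiv.arrowCongr e (Equiv.refl V)) ψ) (Sum.map id e a)
      = Sum.elim φ ψ a := by
    rintro (a | a) <;> simp
  constructor
  · intro hψ a b hab
    have hs : Function.Surjective (Sum.map id e : ℕ ⊕ H₁.U → ℕ ⊕ H₂.U) :=
      Sum.map_surjective.2 ⟨Function.surjective_id, e.surjective⟩
    obtain ⟨a, rfl⟩ := hs a
    obtain ⟨b, rfl⟩ := hs b
    rw [key, key]
    exact hψ _ _ ((he _ _).1 hab)
  · intro hψ a b hab
    have := hψ _ _ ((he a b).2 hab)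
    rwa [key, key] at this

theorem mul_hom_iff {H₁ H₂ : PLGraph} {V : Type} (G : SimpleGraph V) (φ : ℕ → V)
    (ψ : H₁.U ⊕ H₂.U → V) :
    (∀ a b, (mul H₁ H₂).graph.Adj a b → G.Adj (Sum.elim φ ψ a) (Sum.elim φ ψ b)) ↔
      (∀ a b, H₁.graph.Adj a b →
        G.Adj (Sum.elim φ (ψ ∘ Sum.inl) a) (Sum.elim φ (ψ ∘ Sum.inl) b)) ∧
      (∀ a b, H₂.graph.Adj a b →
        G.Adj (Sum.elim φ (ψ ∘ Sum.inr) a) (Sum.elim φ (ψ ∘ Sum.inr) b)) := by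
  have k1 : ∀ a, Sum.elim φ ψ (Sum.map id Sum.inl a) = Sum.elim φ (ψ ∘ Sum.inl) a := by
    rintro (a | a) <;> simp
  have k2 : ∀ a, Sum.elim φ ψ (Sum.map id Sum.inr a) = Sum.elim φ (ψ ∘ Sum.inr) a := by
    rintro (a | a) <;> simp
  have i1 : Function.Injective (Sum.map id Sum.inl : ℕ ⊕ H₁.U → ℕ ⊕ (H₁.U ⊕ H₂.U)) :=
    Sum.map_injective.2 ⟨Function.injective_id, Sum.inl_injective⟩
  have i2 : Function.Injective (Sum.map id Sum.inr : ℕ ⊕ H₂.U → ℕ ⊕ (H₁.U ⊕ H₂.U)) :=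
    Sum.map_injective.2 ⟨Function.injective_id, Sum.inr_injective⟩
  constructor
  · intro h
    refine ⟨fun a b hab => ?_, fun a b hab => ?_⟩
    · rw [← k1, ← k1]
      exact h _ _ (Or.inl (SimpleGraph.map_adj_apply' hab (i1.ne hab.ne)))
    · rw [← k2, ← k2]
      exact h _ _ (Or.inr (SimpleGraph.map_adj_apply' hab (i2.ne hab.ne)))
  · rintro ⟨h1, h2⟩ a b hab
    rcases hab with hab | hab
    · obtain ⟨_, a, b, hab', rfl, rfl⟩ := (SimpleGraph.map_adj' _ _ _ _).1 hab
      rw [k1, k1]; exact h1 _ _ hab'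
    · obtain ⟨_, a, b, hab', rfl, rfl⟩ := (SimpleGraph.map_adj' _ _ _ _).1 hab
      rw [k2, k2]; exact h2 _ _ hab'

theorem density_mul (H₁ H₂ : PLGraph) {V : Type} (G : SimpleGraph V) (φ : ℕ → V) :
    (mul H₁ H₂).density G φ = H₁.density G φ * H₂.density G φ := by
  unfold density
  have hc : Nat.card (mul H₁ H₂).U = Nat.card H₁.U + Nat.card H₂.U := Nat.card_sum
  rw [hc, pow_add, div_mul_div_comm, ← Nat.cast_mul, ← Nat.card_prod]
  congr 2
  exact Nat.card_congr (((Equiv.sumArrowEquivProdArrow H₁.U H₂.U V).subtypeEquiv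
    (q := fun p => (∀ a b, H₁.graph.Adj a b → G.Adj (Sum.elim φ p.1 a) (Sum.elim φ p.1 b)) ∧
      (∀ a b, H₂.graph.Adj a b → G.Adj (Sum.elim φ p.2 a) (Sum.elim φ p.2 b)))
    (fun ψ => mul_hom_iff G φ ψ)).trans (Equiv.subtypeProdEquivProd
      (p := fun ψ : H₁.U → V => ∀ a b, H₁.graph.Adj a b →
        G.Adj (Sum.elim φ ψ a) (Sum.elim φ ψ b))
      (q := fun ψ : H₂.U → V => ∀ a b, H₂.graph.Adj a b →
        G.Adj (Sum.elim φ ψ a) (Sum.elim φ ψ b))))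

theorem density_of_bot (H : PLGraph) (h : H.graph = ⊥) {V : Type} [Finite V] [Nonempty V]
    (G : SimpleGraph V) (φ : ℕ → V) : H.density G φ = 1 := by
  unfold density
  have : Nat.card {ψ : H.U → V // ∀ a b, H.graph.Adj a b →
      G.Adj (Sum.elim φ ψ a) (Sum.elim φ ψ b)} = Nat.card V ^ Nat.card H.U := by
    rw [← Nat.card_fun]
    exact Nat.card_congr (Equiv.subtypeUnivEquiv fun ψ a b hab => by simp [h] at hab)
  rw [this]
  have : (Nat.card V : ℝ) ≠ 0 := by exact_mod_cast Nat.card_pos.ne'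
  push_cast
  exact div_self (pow_ne_zero _ this)

theorem mul_congr {H₁ H₂ K₁ K₂ : PLGraph} (h : Iso H₁ K₁) (h' : Iso H₂ K₂) :
    Iso (mul H₁ H₂) (mul K₁ K₂) := by
  obtain ⟨h, e, he⟩ := h.exists_map
  obtain ⟨h', e', he'⟩ := h'.exists_map
  refine Iso.of_map (by simp [mul, h, h']) (Equiv.sumCongr e e') ?_
  simp only [mul, map_sup, ← he, ← he', SimpleGraph.map_map]
  congr 2 <;> (ext (x | x) <;> rfl)

theorem mul_comm' (H₁ H₂ : PLGraph) : Iso (mul H₁ H₂) (mul H₂ H₁) := by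
  refine Iso.of_map (Finset.union_comm _ _) (Equiv.sumComm _ _) ?_
  simp only [mul, map_sup, SimpleGraph.map_map]
  rw [sup_comm]
  congr 2 <;> (ext (x | x) <;> rfl)

theorem mul_assoc' (H₁ H₂ H₃ : PLGraph) :
    Iso (mul (mul H₁ H₂) H₃) (mul H₁ (mul H₂ H₃)) := by
  refine Iso.of_map (Finset.union_assoc _ _ _) (Equiv.sumAssoc _ _ _) ?_
  simp only [mul, map_sup, SimpleGraph.map_map]
  rw [sup_assoc]
  refine congrArg₂ _ ?_ (congrArg₂ _ ?_ ?_) <;>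
    (refine congrArg₂ _ ?_ rfl; ext (x | x) <;> rfl)

theorem map_bot' {V W : Type*} (f : V → W) : (⊥ : SimpleGraph V).map f = ⊥ := by
  ext x y
  simp [SimpleGraph.map_adj']

/-- Multiplying by an edgeless graph with no unlabeled vertex and no new label changes nothing. -/
theorem mul_absorb (H E : PLGraph) (hE : E.graph = ⊥) (hl : E.labels ⊆ H.labels)
    [IsEmpty E.U] : Iso (mul H E) H := by
  refine Iso.of_map (Finset.union_eq_left.2 hl) (Equiv.sumEmpty _ _) ?_
  have : Sum.map id (Equiv.sumEmpty H.U E.U) ∘ Sum.map id Sum.inl = (id : ℕ ⊕ H.U → ℕ ⊕ H.U) := by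
    ext (x | x) <;> rfl
  simp only [mul, hE, map_bot', SimpleGraph.map_map, sup_bot_eq]
  exact (congrArg (fun f => H.graph.map f) this).trans (SimpleGraph.map_id _)

theorem mul_empty (H : PLGraph) : Iso (mul H empty) H := by
  have : IsEmpty empty.U := inferInstanceAs (IsEmpty Empty)
  exact mul_absorb H empty rfl (Finset.empty_subset _)

theorem unlabelMap_of_pos {H : PLGraph} {T : Set ℕ} {l : ℕ} (h : l ∈ H.labels ∧ l ∉ T) :
    H.unlabelMap T (Sum.inl l) = Sum.inr (Sum.inr ⟨l, h⟩) := dif_pos h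

theorem unlabelMap_of_neg {H : PLGraph} {T : Set ℕ} {l : ℕ} (h : ¬ (l ∈ H.labels ∧ l ∉ T)) :
    H.unlabelMap T (Sum.inl l) = Sum.inl l := dif_neg h

theorem unlabel_congr (T : Set ℕ) {H₁ H₂ : PLGraph} (h : Iso H₁ H₂) :
    Iso (H₁.unlabel T) (H₂.unlabel T) := by
  obtain ⟨h, e, he⟩ := h.exists_map
  refine Iso.of_map (by simp [unlabel, h])
    (Equiv.sumCongr e (Equiv.subtypeEquivRight fun l => by rw [h])) ?_
  simp only [unlabel, ← he, SimpleGraph.map_map]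
  refine congrArg₂ _ ?_ rfl
  funext x
  rcases x with x | x
  · by_cases hx : x ∈ H₂.labels ∧ x ∉ T
    · have hx' : x ∈ H₁.labels ∧ x ∉ T := by rwa [h]
      simp only [Function.comp, Sum.map_inl, id]
      rw [unlabelMap_of_pos hx, unlabelMap_of_pos hx']
      rfl
    · have hx' : ¬ (x ∈ H₁.labels ∧ x ∉ T) := by rwa [h]
      simp only [Function.comp, Sum.map_inl, id]
      rw [unlabelMap_of_neg hx, unlabelMap_of_neg hx']
      rfl
  · rfl

theorem map_eq_of_agree {V W : Type*} (G : SimpleGraph V) (f g : V → W)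
    (h : ∀ c d, G.Adj c d → f c = g c) : G.map f = G.map g := by
  ext a b
  rw [SimpleGraph.map_adj', SimpleGraph.map_adj']
  refine and_congr_right fun _ => ?_
  constructor
  · rintro ⟨c, d, hcd, r1, r2⟩
    exact ⟨c, d, hcd, (h c d hcd).symm.trans r1, (h d c hcd.symm).symm.trans r2⟩
  · rintro ⟨c, d, hcd, r1, r2⟩
    exact ⟨c, d, hcd, (h c d hcd).trans r1, (h d c hcd.symm).trans r2⟩

/-- Adding isolated vertices and then unlabeling, compared with unlabeling and then adding
isolated vertices. -/
theorem unlabel_mul_bot (T : Set ℕ) (H E E' : PLGraph) (hE : E.graph = ⊥) (hE' : E'.graph = ⊥)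
    (hlab : ((mul H E).unlabel T).labels = (mul (H.unlabel T) E').labels)
    (e : (H.U ⊕ E.U) ⊕ {l : ℕ // l ∈ (mul H E).labels ∧ l ∉ T} ≃
      (H.U ⊕ {l : ℕ // l ∈ H.labels ∧ l ∉ T}) ⊕ E'.U)
    (h1 : ∀ u, e (Sum.inl (Sum.inl u)) = Sum.inl (Sum.inl u))
    (h2 : ∀ l (h : l ∈ H.labels ∧ l ∉ T) (h' : l ∈ (mul H E).labels ∧ l ∉ T),
      e (Sum.inr ⟨l, h'⟩) = Sum.inl (Sum.inr ⟨l, h⟩)) :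
    Iso ((mul H E).unlabel T) (mul (H.unlabel T) E') := by
  refine Iso.of_map hlab e ?_
  have g1 : ∀ H₁ : PLGraph, (mul H₁ E).graph =
      H₁.graph.map (fun x => (Sum.map id Sum.inl x : ℕ ⊕ (mul H₁ E).U)) := by
    intro H₁
    change H₁.graph.map _ ⊔ E.graph.map _ = _
    rw [hE, map_bot', sup_bot_eq]
    rfl
  have g2 : ∀ H₁ : PLGraph, (mul H₁ E').graph =
      H₁.graph.map (fun x => (Sum.map id Sum.inl x : ℕ ⊕ (mul H₁ E').U)) := by
    intro H₁
    change H₁.graph.map _ ⊔ E'.graph.map _ = _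
    rw [hE', map_bot', sup_bot_eq]
    rfl
  rw [g2]
  change ((mul H E).graph.map ((mul H E).unlabelMap T)).map _ = (H.graph.map (H.unlabelMap T)).map _
  rw [g1, SimpleGraph.map_map]
  refine (SimpleGraph.map_map H.graph _ _).trans
    (Eq.trans ?_ (SimpleGraph.map_map H.graph _ _).symm)
  have key : ∀ c d, H.graph.Adj c d →
      (Sum.map id e ((mul H E).unlabelMap T (Sum.map id Sum.inl c)) : ℕ ⊕ _) =
      Sum.map id Sum.inl (H.unlabelMap T c) := by
    intro c d hcd
    rcases c with x | x
    · have hxl := H.mem_labels _ _ hcd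
      have hxl' : x ∈ (mul H E).labels := Finset.mem_union_left _ hxl
      change Sum.map id e ((mul H E).unlabelMap T (Sum.inl x)) = _
      by_cases hx : x ∈ T
      · rw [unlabelMap_of_neg (fun h => h.2 hx), unlabelMap_of_neg (fun h => h.2 hx)]
        rfl
      · rw [unlabelMap_of_pos ⟨hxl, hx⟩, unlabelMap_of_pos ⟨hxl', hx⟩]
        exact congrArg Sum.inr (h2 x ⟨hxl, hx⟩ ⟨hxl', hx⟩)
    · exact congrArg Sum.inr (h1 x)
  exact map_eq_of_agree _ _ _ key

theorem unlabel_mul_point (T : Set ℕ) (H : PLGraph) :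
    Iso ((mul H point).unlabel T) (mul (H.unlabel T) point) := by
  have hX : ∀ l, (l ∈ (mul H point).labels ∧ l ∉ T) ↔ (l ∈ H.labels ∧ l ∉ T) := by
    intro l; simp [mul, point]
  let e : (H.U ⊕ Unit) ⊕ {l : ℕ // l ∈ (mul H point).labels ∧ l ∉ T} ≃
      (H.U ⊕ {l : ℕ // l ∈ H.labels ∧ l ∉ T}) ⊕ Unit :=
    { toFun := Sum.elim (Sum.elim (fun u => Sum.inl (Sum.inl u)) (fun _ => Sum.inr ()))
        (fun l => Sum.inl (Sum.inr ⟨l.1, (hX l.1).1 l.2⟩))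
      invFun := Sum.elim (Sum.elim (fun u => Sum.inl (Sum.inl u))
        (fun l => Sum.inr ⟨l.1, (hX l.1).2 l.2⟩)) (fun _ => Sum.inl (Sum.inr ()))
      left_inv := by rintro ((u | u) | l) <;> rfl
      right_inv := by rintro ((u | l) | u) <;> rfl }
  exact unlabel_mul_bot T H point point rfl rfl (by simp [mul, unlabel, point]) e (fun _ => rfl)
    (fun _ _ _ => rfl)

theorem unlabel_mul_labeledPoint_of_mem (T : Set ℕ) (H : PLGraph) (k : ℕ) (hk : k ∈ T) :
    Iso ((mul H (labeledPoint k)).unlabel T) (mul (H.unlabel T) (labeledPoint k)) := by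
  have hX : ∀ l, (l ∈ (mul H (labeledPoint k)).labels ∧ l ∉ T) ↔ (l ∈ H.labels ∧ l ∉ T) := by
    intro l
    simp only [mul, labeledPoint, Finset.mem_union, Finset.mem_singleton]
    constructor
    · rintro ⟨h | rfl, h'⟩
      · exact ⟨h, h'⟩
      · exact absurd hk h'
    · rintro ⟨h, h'⟩
      exact ⟨Or.inl h, h'⟩
  let e : (H.U ⊕ Empty) ⊕ {l : ℕ // l ∈ (mul H (labeledPoint k)).labels ∧ l ∉ T} ≃
      (H.U ⊕ {l : ℕ // l ∈ H.labels ∧ l ∉ T}) ⊕ Empty :=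
    { toFun := Sum.elim (Sum.elim (fun u => Sum.inl (Sum.inl u)) Sum.inr)
        (fun l => Sum.inl (Sum.inr ⟨l.1, (hX l.1).1 l.2⟩))
      invFun := Sum.elim (Sum.elim (fun u => Sum.inl (Sum.inl u))
        (fun l => Sum.inr ⟨l.1, (hX l.1).2 l.2⟩)) (fun u => Sum.inl (Sum.inr u))
      left_inv := by rintro ((u | u) | l) <;> rfl
      right_inv := by rintro ((u | l) | u) <;> rfl }
  refine unlabel_mul_bot T H (labeledPoint k) (labeledPoint k) rfl rfl ?_ e (fun _ => rfl) (fun _ _ _ => rfl)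
  ext l
  simp only [mul, unlabel, labeledPoint, Finset.mem_filter, Finset.mem_union,
    Finset.mem_singleton]
  constructor
  · rintro ⟨h | h, h'⟩
    · exact Or.inl ⟨h, h'⟩
    · exact Or.inr h
  · rintro (⟨h, h'⟩ | rfl)
    · exact ⟨Or.inl h, h'⟩
    · exact ⟨Or.inr rfl, hk⟩

theorem unlabel_mul_labeledPoint_of_notMem (T : Set ℕ) (H : PLGraph) (k : ℕ) (hk : k ∉ T)
    (hk' : k ∉ H.labels) :
    Iso ((mul H (labeledPoint k)).unlabel T) (mul (H.unlabel T) point) := by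
  have hX : ∀ l, (l ∈ (mul H (labeledPoint k)).labels ∧ l ∉ T) ↔
      (l ∈ H.labels ∧ l ∉ T) ∨ l = k := by
    intro l
    simp only [mul, labeledPoint, Finset.mem_union, Finset.mem_singleton]
    constructor
    · rintro ⟨h | h, h'⟩
      · exact Or.inl ⟨h, h'⟩
      · exact Or.inr h
    · rintro (⟨h, h'⟩ | rfl)
      · exact ⟨Or.inl h, h'⟩
      · exact ⟨Or.inr rfl, hk⟩
  let e : (H.U ⊕ Empty) ⊕ {l : ℕ // l ∈ (mul H (labeledPoint k)).labels ∧ l ∉ T} ≃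
      (H.U ⊕ {l : ℕ // l ∈ H.labels ∧ l ∉ T}) ⊕ Unit :=
    { toFun := Sum.elim (Sum.elim (fun u => Sum.inl (Sum.inl u)) Empty.elim)
        (fun l => if h : l.1 ∈ H.labels ∧ l.1 ∉ T then Sum.inl (Sum.inr ⟨l.1, h⟩)
          else Sum.inr ())
      invFun := Sum.elim (Sum.elim (fun u => Sum.inl (Sum.inl u))
        (fun l => Sum.inr ⟨l.1, (hX l.1).2 (Or.inl l.2)⟩))
        (fun _ => Sum.inr ⟨k, (hX k).2 (Or.inr rfl)⟩)
      left_inv := by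
        rintro ((u | u) | ⟨l, hl⟩)
        · rfl
        · exact u.elim
        · by_cases h : l ∈ H.labels ∧ l ∉ T
          · simp only [Sum.elim_inr, dif_pos h, Sum.elim_inl]
          · have hlk : l = k := ((hX l).1 hl).resolve_left h
            subst hlk
            simp only [Sum.elim_inr, dif_neg h]
      right_inv := by
        rintro ((u | ⟨l, hl⟩) | u)
        · rfl
        · simp only [Sum.elim_inl, Sum.elim_inr, dif_pos hl]
        · have : ¬ (k ∈ H.labels ∧ k ∉ T) := fun h => hk' h.1
          simp only [Sum.elim_inr, dif_neg this] }
  refine unlabel_mul_bot T H (labeledPoint k) point rfl rfl ?_ e (fun _ => rfl) (fun _ h _ => dif_pos h)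
  ext l
  simp only [mul, unlabel, labeledPoint, point, Finset.mem_filter, Finset.mem_union,
    Finset.mem_singleton, Finset.notMem_empty, or_false]
  constructor
  · rintro ⟨h | rfl, h'⟩
    · exact ⟨h, h'⟩
    · exact absurd h' hk
  · rintro ⟨h, h'⟩
    exact ⟨Or.inl h, h'⟩

end PLGraph

/-- Partially labeled graphs up to label-preserving isomorphism. -/
def PL : Type 1 := Quotient PLGraph.setoid

namespace PL

/-- The isomorphism class of a partially labeled graph. -/
def mk (H : PLGraph) : PL := Quotient.mk _ H

theorem mk_eq {H₁ H₂ : PLGraph} (h : PLGraph.Iso H₁ H₂) : mk H₁ = mk H₂ := Quotient.sound h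

instance : CommMonoid PL where
  mul := Quotient.map₂ PLGraph.mul fun _ _ h _ _ h' => PLGraph.mul_congr h h'
  one := mk PLGraph.empty
  mul_assoc := by
    rintro ⟨a⟩ ⟨b⟩ ⟨c⟩
    exact Quotient.sound (PLGraph.mul_assoc' a b c)
  mul_comm := by
    rintro ⟨a⟩ ⟨b⟩
    exact Quotient.sound (PLGraph.mul_comm' a b)
  mul_one := by
    rintro ⟨a⟩
    exact Quotient.sound (PLGraph.mul_empty a)
  one_mul := by
    rintro ⟨a⟩
    exact Quotient.sound ((PLGraph.mul_comm' _ a).trans (PLGraph.mul_empty a))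

theorem mk_mul (H₁ H₂ : PLGraph) : mk H₁ * mk H₂ = mk (PLGraph.mul H₁ H₂) := rfl

theorem one_eq : (1 : PL) = mk PLGraph.empty := rfl

/-- The set of labels. -/
def labels : PL → Finset ℕ := Quotient.lift PLGraph.labels fun _ _ h => h.1

/-- Removal of the labels outside `T`. -/
def unlabel (T : Set ℕ) : PL → PL :=
  Quotient.map (PLGraph.unlabel T) fun _ _ h => PLGraph.unlabel_congr T h

/-- The homomorphism density `t(H; G, φ)`, as a function of `H`. -/
def density {V : Type} [Finite V] [Nonempty V] (G : SimpleGraph V) (φ : ℕ → V) : PL →* ℝ where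
  toFun := Quotient.lift (fun H => PLGraph.density H G φ) fun _ _ h => PLGraph.density_congr h G φ
  map_one' := PLGraph.density_of_bot PLGraph.empty rfl G φ
  map_mul' := by
    rintro ⟨a⟩ ⟨b⟩
    exact PLGraph.density_mul a b G φ

/-- The one-vertex graphs. -/
def IsPoint (F : PL) : Prop := F = mk PLGraph.point ∨ ∃ l, F = mk (PLGraph.labeledPoint l)

theorem density_isPoint {V : Type} [Finite V] [Nonempty V] (G : SimpleGraph V) (φ : ℕ → V)
    {F : PL} (hF : F.IsPoint) : density G φ F = 1 := by
  rcases hF with rfl | ⟨l, rfl⟩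
  · exact PLGraph.density_of_bot _ rfl G φ
  · exact PLGraph.density_of_bot _ rfl G φ

/-- Unlabeling turns the addition of an isolated vertex into nothing or into the addition of an
isolated vertex. -/
theorem unlabel_mul_isPoint (T : Set ℕ) (H F : PL) (hF : F.IsPoint) :
    unlabel T (H * F) = unlabel T H ∨
      ∃ F' : PL, F'.IsPoint ∧ unlabel T (H * F) = unlabel T H * F' := by
  rcases H with ⟨H⟩
  rcases hF with rfl | ⟨l, rfl⟩
  · exact Or.inr ⟨_, Or.inl rfl, mk_eq (PLGraph.unlabel_mul_point T H)⟩
  · by_cases hT : l ∈ T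
    · exact Or.inr ⟨_, Or.inr ⟨l, rfl⟩, mk_eq (PLGraph.unlabel_mul_labeledPoint_of_mem T H l hT)⟩
    · by_cases hl : l ∈ H.labels
      · have : IsEmpty (PLGraph.labeledPoint l).U := inferInstanceAs (IsEmpty Empty)
        exact Or.inl (mk_eq (PLGraph.unlabel_congr T (PLGraph.mul_absorb H
          (PLGraph.labeledPoint l) rfl (Finset.singleton_subset_iff.2 hl))))
      · exact Or.inr ⟨_, Or.inl rfl,
          mk_eq (PLGraph.unlabel_mul_labeledPoint_of_notMem T H l hT hl)⟩

end PL

/-- Labeled quantum graphs: formal real linear combinations of partially labeled graphs. -/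
abbrev QG : Type 1 := MonoidAlgebra ℝ PL

/-- The ideal generated by the differences `F - ∅` with `F` a one-vertex graph. -/
def K : Ideal QG := Ideal.span {x | ∃ F : PL, F.IsPoint ∧ x = MonoidAlgebra.of ℝ PL F - 1}

/-- The quotient algebra, in which isolated vertices do not count. -/
abbrev A : Type 1 := QG ⧸ K

/-- The subspace of `QG` spanned by the partially labeled graphs with label set exactly `L`. -/
def QGL (L : Finset ℕ) : Submodule ℝ QG :=
  Submodule.span ℝ {x | ∃ F : PL, F.labels = L ∧ x = MonoidAlgebra.of ℝ PL F}

/-- The subspace of `A` of the classes of elements of `QGL L`. -/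
def AL (L : Finset ℕ) : Submodule ℝ A := (QGL L).map (Ideal.Quotient.mkₐ ℝ K).toLinearMap

/-- The density `t(f; G, φ)` for labeled quantum graphs `f`. -/
def densityQG {V : Type} [Finite V] [Nonempty V] (G : SimpleGraph V) (φ : ℕ → V) : QG →ₐ[ℝ] ℝ :=
  MonoidAlgebra.lift ℝ ℝ PL (PL.density G φ)

/-- The density `t(f; G, φ)` for `f` in the quotient algebra. -/
def density {V : Type} [Finite V] [Nonempty V] (G : SimpleGraph V) (φ : ℕ → V) : A →ₐ[ℝ] ℝ :=
  Ideal.Quotient.liftₐ K (densityQG G φ) (by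
    intro a ha
    have hle : K ≤ RingHom.ker (densityQG G φ) := by
      refine Ideal.span_le.2 ?_
      rintro _ ⟨F, hF, rfl⟩
      simp [densityQG, RingHom.mem_ker, PL.density_isPoint G φ hF]
    exact hle ha)

/-- Unlabeling of labeled quantum graphs. -/
def unlabelQG (T : Set ℕ) : QG →ₗ[ℝ] QG := MonoidAlgebra.mapDomainLinearMap ℝ ℝ (PL.unlabel T)

theorem unlabelQG_of (T : Set ℕ) (F : PL) :
    unlabelQG T (MonoidAlgebra.of ℝ PL F) = MonoidAlgebra.of ℝ PL (F.unlabel T) :=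
  MonoidAlgebra.mapDomainLinearMap_single _ _ _

theorem unlabelQG_mem (T : Set ℕ) {x : QG} (hx : x ∈ K) : unlabelQG T x ∈ K := by
  have hsmul : ∀ (r : ℝ) (y : QG), y ∈ K → r • y ∈ K := fun r y hy =>
    Submodule.smul_of_tower_mem K r hy
  have hgen : ∀ (a : QG) (F : PL), F.IsPoint →
      unlabelQG T (a * (MonoidAlgebra.of ℝ PL F - 1)) ∈ K := by
    intro a F hF
    induction a using MonoidAlgebra.induction_on with
    | of H =>
      rw [mul_sub, mul_one, ← map_mul, map_sub, unlabelQG_of, unlabelQG_of]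
      rcases PL.unlabel_mul_isPoint T H F hF with h | ⟨F', hF', h⟩
      · rw [h, sub_self]
        exact K.zero_mem
      · rw [h, map_mul, ← mul_sub_one]
        exact K.mul_mem_left _ (Ideal.subset_span ⟨F', hF', rfl⟩)
    | add a b ha hb =>
      rw [add_mul, map_add]
      exact K.add_mem ha hb
    | smul r a ha =>
      rw [smul_mul_assoc, map_smul]
      exact hsmul r _ ha
  have key : ∀ x ∈ K, ∀ a : QG, unlabelQG T (a * x) ∈ K := by
    intro x hx
    induction hx using Submodule.span_induction with
    | mem x hx =>
      obtain ⟨F, hF, rfl⟩ := hx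
      exact fun a => hgen a F hF
    | zero => intro a; simp
    | add x y _ _ hx hy =>
      intro a
      rw [mul_add, map_add]
      exact K.add_mem (hx a) (hy a)
    | smul b x _ hx =>
      intro a
      rw [smul_eq_mul, ← mul_assoc]
      exact hx _
  simpa using key x hx 1

/-- The linear map `⟦·⟧_T` on the quotient algebra: removal of the labels outside `T`. -/
def unlabel (T : Set ℕ) : A →ₗ[ℝ] A :=
  (Submodule.Quotient.restrictScalarsEquiv ℝ K).toLinearMap ∘ₗ
    (Submodule.mapQ (K.restrictScalars ℝ) (K.restrictScalars ℝ) (unlabelQG T)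
      fun _ hx => unlabelQG_mem T hx) ∘ₗ
    (Submodule.Quotient.restrictScalarsEquiv ℝ K).symm.toLinearMap

theorem unlabel_mk (T : Set ℕ) (x : QG) :
    unlabel T (Ideal.Quotient.mk K x) = Ideal.Quotient.mk K (unlabelQG T x) := rfl

/-- `f ≥ 0`: all densities of `f` in (nonempty, finite, simple) graphs `G` are nonnegative. -/
def Positive (f : A) : Prop :=
  ∀ (V : Type) [Finite V] [Nonempty V] (G : SimpleGraph V) (φ : ℕ → V), 0 ≤ density G φ f

/-- Provability of the statement `f ≥ 0` in the Cauchy–Schwarz calculus. -/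
inductive CSPositive : A → Prop
  | sq (f : A) : CSPositive (f ^ 2)
  | cauchySchwarz (L T : Finset ℕ) (hT : T ⊆ L) (f₁ f₂ : A) (h₁ : f₁ ∈ AL L) (h₂ : f₂ ∈ AL L) :
      CSPositive (unlabel T (f₁ ^ 2) * unlabel T (f₂ ^ 2) - unlabel T (f₁ * f₂) ^ 2)
  | combination (f g : A) (α β : ℝ) (hα : 0 ≤ α) (hβ : 0 ≤ β) :
      CSPositive f → CSPositive g → CSPositive (α • f + β • g)
  | mul (f g : A) : CSPositive f → CSPositive g → CSPositive (f * g)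
  | unlabel (T : Set ℕ) (f : A) : CSPositive f → CSPositive (unlabel T f)

end QuantumGraph

end

noncomputable section

open scoped Classical

namespace QuantumGraph

/-! The separating element is `cycleWitness`, a polynomial in the densities of the edge, the
triangle, the 4-cycle and the 6-cycle. In a graph these are the power sums of exponents 2, 3, 4, 6
of the eigenvalues of the adjacency matrix divided by the number of vertices.

Positivity rests on integrality. Rescale the eigenvalues so that the power sums of exponents 2 and 4
have a common value a, and let b and c be those of exponents 3 and 6. Then c - a is the sum of y^2
(y^2 - 1)^2, so if it is small, all y are nearly in {-1, 0, 1} in an averaged sense. Hence a and b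
are nearly integers and a - b^2 stays away from 1/2. Thus (a - b^2 - 1/2)^2 exceeds 1/8 unless the
penalty 1250 a^3 (c - a) does (`normalized_power_sum_inequality`); clearing denominators gives
`power_sum_inequality`.

The calculus cannot see this integrality. Take c looped points (c is now a number of points) and N
disjoint edges. The eigenvalues of the adjacency matrix are ±1, the penalty vanishes, and the
rescaled a and b are c + 2N and c. All densities are rational functions of N, so N may be replaced
by a real number μ. A sum over points then becomes a sum over the loops, over the pairs already
occupied, and (μ minus the number of occupied pairs) times a sum over one fresh pair. A given
derivation involves only finitely many labels, so for μ above a bound depending on the derivation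
alone these weights are nonnegative, and every axiom and rule remains sound
(`Cell.exists_hasValue_sum`, `CSPositive.exists_valueNonneg`). That bound does not depend on c, so c
can be chosen afterwards, large enough that the μ with c + 2μ - c^2 = 1/2 exceeds it. There the
witness has a negative value, so no derivation exists. -/

/-! ### Power sums and their near-integrality. -/

/-- Rounding a real number near `1` or `-1` to that number and any other number to `0`. -/
def roundSign (y : ℝ) : ℤ := if |y ^ 2 - 1| < 1 / 2 then (if 0 ≤ y then 1 else -1) else 0

/-- The weight y^2 |y^2 - 1| dominates the rounding errors of both y^2 and y^3, and its sum is
controlled by c - a through Cauchy–Schwarz. -/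
theorem abs_sq_sub_roundSign_sq_le (y : ℝ) :
    |y ^ 2 - (roundSign y : ℝ) ^ 2| ≤ 2 * (y ^ 2 * |y ^ 2 - 1|) := by
  unfold roundSign
  by_cases h : |y ^ 2 - 1| < 1 / 2
  · have h2 := (abs_lt.1 h).1
    have h3 : |y ^ 2 - 1| ≤ 2 * (y ^ 2 * |y ^ 2 - 1|) := by
      nlinarith [abs_nonneg (y ^ 2 - 1)]
    split_ifs <;> simpa using h3
  · rw [if_neg h]
    push Not at h
    have : |y ^ 2| = y ^ 2 := abs_of_nonneg (sq_nonneg y)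
    simp only [Int.cast_zero, ne_eq, OfNat.ofNat_ne_zero, not_false_eq_true, zero_pow, sub_zero, this]
    nlinarith [sq_nonneg y]

/-- Both y^3 - 1 and y^2 - 1 are divisible by y - 1, and the remaining factors are comparable
because y > 7/10. -/
theorem abs_cube_sub_one_le {y : ℝ} (hy : 0 ≤ y) (h : |y ^ 2 - 1| < 1 / 2) :
    |y ^ 3 - 1| ≤ 4 * (y ^ 2 * |y ^ 2 - 1|) := by
  have h2 := (abs_lt.1 h).1
  have h3 : 7 / 10 < y := by nlinarith
  have e1 : |y ^ 3 - 1| * (y + 1) = |y ^ 2 - 1| * (y ^ 2 + y + 1) := by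
    have p1 : 0 ≤ y + 1 := by linarith
    have p2 : 0 ≤ y ^ 2 + y + 1 := by positivity
    rw [← abs_of_nonneg p1, ← abs_of_nonneg p2, ← abs_mul, ← abs_mul]
    congr 1
    ring
  have e2 : y ^ 2 + y + 1 ≤ 4 * y ^ 2 * (y + 1) := by nlinarith
  have e3 := mul_le_mul_of_nonneg_left e2 (abs_nonneg (y ^ 2 - 1))
  have : 0 < y + 1 := by linarith
  refine le_of_mul_le_mul_right ?_ this
  rw [e1]
  linarith

theorem abs_cube_sub_roundSign_le (y : ℝ) :
    |y ^ 3 - (roundSign y : ℝ)| ≤ 4 * (y ^ 2 * |y ^ 2 - 1|) := by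
  unfold roundSign
  by_cases h : |y ^ 2 - 1| < 1 / 2
  · rw [if_pos h]
    split_ifs with hy
    · simpa using abs_cube_sub_one_le hy h
    · have := abs_cube_sub_one_le (y := -y) (by linarith) (by simpa using h)
      have e : |y ^ 3 - ((-1 : ℤ) : ℝ)| = |(-y) ^ 3 - 1| := by
        rw [← abs_neg]
        congr 1
        push_cast
        ring
      rw [e]
      simpa using this
  · rw [if_neg h]
    push Not at h
    have e : |y ^ 3 - ((0 : ℤ) : ℝ)| = y ^ 2 * |y| := by
      rw [Int.cast_zero, sub_zero, abs_pow, pow_succ, sq_abs]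
    rw [e]
    have : |y| ≤ 4 * |y ^ 2 - 1| := by
      rcases le_abs.1 h with h1 | h1
      · have := le_abs_self (y ^ 2 - 1)
        have h4 := sq_abs y
        nlinarith [abs_nonneg y]
      · have := sq_abs y
        nlinarith [abs_nonneg y]
    nlinarith [sq_nonneg y]

/-- If the power sums of exponents two and four agree and the power sum of exponent six is not much
larger, then the power sums of exponents two and three are nearly integers. -/
theorem normalized_power_sum_inequality {ι : Type*} [Fintype ι] (y : ι → ℝ) {a b c : ℝ}
    (h2 : ∑ i, y i ^ 2 = a) (h3 : ∑ i, y i ^ 3 = b) (h4 : ∑ i, y i ^ 4 = a)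
    (h6 : ∑ i, y i ^ 6 = c) :
    0 ≤ 1250 * (a ^ 3 * (c - a)) + (a - b ^ 2 - 1 / 2) ^ 2 - 1 / 8 := by
  set R := ∑ i, y i ^ 2 * |y i ^ 2 - 1| with hR
  have ha0 : 0 ≤ a := h2 ▸ Finset.sum_nonneg fun i _ => sq_nonneg _
  have hR0 : 0 ≤ R := Finset.sum_nonneg fun i _ => by positivity
  -- The equality of the power sums of exponents 2 and 4 turns c - a into a sum of squares measuring
  -- the distance of the y from {-1, 0, 1}.
  have hπ : ∑ i, y i ^ 2 * (y i ^ 2 - 1) ^ 2 = c - a := by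
    have : ∀ i, y i ^ 2 * (y i ^ 2 - 1) ^ 2 = y i ^ 6 - 2 * y i ^ 4 + y i ^ 2 := fun i => by ring
    simp only [this, Finset.sum_add_distrib, Finset.sum_sub_distrib, ← Finset.mul_sum, h2, h4, h6]
    ring
  have hπ0 : 0 ≤ c - a := hπ ▸ Finset.sum_nonneg fun i _ => by positivity
  have hRle : R ^ 2 ≤ a * (c - a) := by
    have := Finset.sum_mul_sq_le_sq_mul_sq Finset.univ (fun i => y i)
      (fun i => y i * |y i ^ 2 - 1|)
    rw [h2] at this
    calc R ^ 2 = (∑ i, y i * (y i * |y i ^ 2 - 1|)) ^ 2 := by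
          rw [hR]; congr 1; exact Finset.sum_congr rfl fun i _ => by ring
      _ ≤ a * ∑ i, (y i * |y i ^ 2 - 1|) ^ 2 := this
      _ = a * (c - a) := by
          rw [← hπ]; congr 1
          exact Finset.sum_congr rfl fun i _ => by rw [mul_pow, sq_abs]
  by_cases hbig : 1 / 8 ≤ 1250 * (a ^ 3 * (c - a))
  · nlinarith [sq_nonneg (a - b ^ 2 - 1 / 2)]
  push Not at hbig
  -- This leaves only a = 0 or a ≥ 1.
  have haa : a ≤ a ^ 2 := by
    have h : ∑ i, (y i ^ 2) ^ 2 ≤ (∑ i, y i ^ 2) ^ 2 :=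
      Finset.sum_sq_le_sq_sum_of_nonneg fun i _ => sq_nonneg _
    rw [h2] at h
    calc a = ∑ i, (y i ^ 2) ^ 2 := by
          rw [← h4]; exact Finset.sum_congr rfl fun i _ => by ring
      _ ≤ a ^ 2 := h
  have hb : |b| ≤ a := by
    rw [← h3]
    refine (Finset.abs_sum_le_sum_abs _ _).trans ?_
    have : ∀ i, |y i ^ 3| ≤ (y i ^ 2 + y i ^ 4) / 2 := by
      intro i
      have h1 : |y i ^ 3| = y i ^ 2 * |y i| := by rw [abs_pow, pow_succ, sq_abs]
      rw [h1]
      have := sq_abs (y i)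
      nlinarith [sq_nonneg (y i), sq_nonneg (|y i| - 1), mul_nonneg (sq_nonneg (y i)) (sq_nonneg (|y i| - 1))]
    refine (Finset.sum_le_sum fun i _ => this i).trans ?_
    rw [← Finset.sum_div, Finset.sum_add_distrib, h2, h4]
    linarith
  rcases eq_or_lt_of_le ha0 with ha | ha
  · rw [← ha] at hb ⊢
    have : b = 0 := abs_nonpos_iff.1 hb
    rw [this]
    norm_num
  have ha1 : 1 ≤ a := by nlinarith
  -- The constant 1250 is used here: 1/(8 · 1250) = (1/100)^2.
  have haR : a * R ≤ 1 / 100 := by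
    have : (a * R) ^ 2 ≤ (1 / 100) ^ 2 := by
      have := mul_le_mul_of_nonneg_left hRle (sq_nonneg a)
      nlinarith
    exact (pow_le_pow_iff_left₀ (by positivity) (by norm_num) (by norm_num)).1 this
  set N : ℤ := ∑ i, roundSign (y i) ^ 2 with hN
  set D : ℤ := ∑ i, roundSign (y i) with hD
  have hNa : |a - N| ≤ 2 * R := by
    rw [hN, ← h2, hR, Finset.mul_sum]
    push_cast
    rw [← Finset.sum_sub_distrib]
    exact (Finset.abs_sum_le_sum_abs _ _).trans
      (Finset.sum_le_sum fun i _ => abs_sq_sub_roundSign_sq_le (y i))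
  have hDb : |b - D| ≤ 4 * R := by
    rw [hD, ← h3, hR, Finset.mul_sum]
    push_cast
    rw [← Finset.sum_sub_distrib]
    exact (Finset.abs_sum_le_sum_abs _ _).trans
      (Finset.sum_le_sum fun i _ => abs_cube_sub_roundSign_le (y i))
  have hRs : R ≤ 1 / 100 := by nlinarith
  have hDD : |b ^ 2 - (D : ℝ) ^ 2| ≤ 8 * (a * R) + 16 * (R * R) := by
    have e : b ^ 2 - (D : ℝ) ^ 2 = (b - D) * (2 * b - (b - D)) := by ring
    rw [e, abs_mul]
    have h1 : |2 * b - (b - D)| ≤ 2 * a + 4 * R := by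
      refine (abs_sub _ _).trans ?_
      rw [abs_mul, abs_two]
      linarith
    have := mul_le_mul hDb h1 (abs_nonneg _) (by positivity)
    linarith
  have hZ : 1 / 2 ≤ |((N - D ^ 2 : ℤ) : ℝ) - 1 / 2| := by
    rcases le_or_gt (N - D ^ 2) 0 with h | h
    · have : ((N - D ^ 2 : ℤ) : ℝ) ≤ 0 := by exact_mod_cast h
      rw [abs_of_nonpos] <;> linarith
    · have : (1 : ℝ) ≤ ((N - D ^ 2 : ℤ) : ℝ) := by exact_mod_cast h
      rw [abs_of_nonneg] <;> linarith
  push_cast at hZ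
  -- The error is at most 2R + 8aR + 16R^2, which is below 1/8. The remaining distance is 1/2 - 1/8
  -- = 3/8, and (3/8)^2 > 1/8.
  have hclose : |((N : ℝ) - D ^ 2 - 1 / 2) - (a - b ^ 2 - 1 / 2)| ≤ 1 / 8 := by
    rw [abs_le] at hNa hDD ⊢
    constructor <;> nlinarith
  have hfin : 3 / 8 ≤ |a - b ^ 2 - 1 / 2| := by
    have := abs_sub_abs_le_abs_sub ((N : ℝ) - D ^ 2 - 1 / 2) (a - b ^ 2 - 1 / 2)
    linarith
  have : (3 / 8) ^ 2 ≤ (a - b ^ 2 - 1 / 2) ^ 2 := by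
    rw [← sq_abs (a - b ^ 2 - 1 / 2)]
    exact pow_le_pow_left₀ (by norm_num) hfin 2
  have : 0 ≤ a ^ 3 * (c - a) := by positivity
  linarith

/-- The homogeneous form of the normalized inequality: substitute a = e^2/m₂, b^2 = m₁^2 e^3/m₂^3, c
= m₄ e^3/m₂^3 and multiply by m₂^6. Being polynomial, it can be read as a statement about a quantum
graph. -/
theorem power_sum_inequality {ι : Type*} [Fintype ι] (z : ι → ℝ) {e m₁ m₂ m₄ : ℝ}
    (he : ∑ i, z i ^ 2 = e) (h₁ : ∑ i, z i ^ 3 = m₁) (h₂ : ∑ i, z i ^ 4 = m₂)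
    (h₄ : ∑ i, z i ^ 6 = m₄) :
    0 ≤ 1250 * (e ^ 8 * (e * m₄ - m₂ ^ 2)) +
      (e ^ 2 * m₂ ^ 2 - m₁ ^ 2 * e ^ 3 - 1 / 2 * m₂ ^ 3) ^ 2 - 1 / 8 * m₂ ^ 6 := by
  by_cases hz : ∀ i, z i = 0
  · have h1 : e = 0 := by rw [← he]; simp [hz]
    have h2 : m₂ = 0 := by rw [← h₂]; simp [hz]
    simp [h1, h2]
  push Not at hz
  obtain ⟨k, hk⟩ := hz
  have hepos : 0 < e := he ▸ Finset.sum_pos' (fun i _ => sq_nonneg _) ⟨k, Finset.mem_univ _, by positivity⟩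
  have hmpos : 0 < m₂ := h₂ ▸ Finset.sum_pos' (fun i _ => by positivity) ⟨k, Finset.mem_univ _, by positivity⟩
  -- Division by this x makes the power sums of exponents 2 and 4 agree.
  obtain ⟨x, hx, hxx⟩ : ∃ x : ℝ, 0 < x ∧ x ^ 2 = m₂ / e :=
    ⟨√(m₂ / e), by positivity, Real.sq_sqrt (by positivity)⟩
  have hm : m₂ = x ^ 2 * e := by rw [hxx]; field_simp
  have hs : ∀ k, ∑ i, (z i / x) ^ k = (∑ i, z i ^ k) / x ^ k := by
    intro k
    rw [Finset.sum_div]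
    exact Finset.sum_congr rfl fun i _ => div_pow _ _ _
  have key := normalized_power_sum_inequality (fun i => z i / x) (a := e / x ^ 2)
    (b := m₁ / x ^ 3) (c := m₄ / x ^ 6) (by rw [hs, he]) (by rw [hs, h₁])
    (by rw [hs, h₂, hm]; field_simp) (by rw [hs, h₄])
  have h := mul_nonneg key (show (0 : ℝ) ≤ m₂ ^ 6 by positivity)
  refine h.trans_eq ?_
  rw [hm]
  field_simp

theorem trace_pow_eq_sum_eigenvalues_pow {V : Type*} [Fintype V] [DecidableEq V]
    {M : Matrix V V ℝ} (hM : M.IsHermitian) (k : ℕ) :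
    (M ^ k).trace = ∑ i, hM.eigenvalues i ^ k := by
  have h := hM.spectral_theorem
  conv_lhs => rw [h]
  rw [← map_pow, Unitary.conjStarAlgAut_apply, Matrix.trace_mul_cycle]
  simp [Matrix.diagonal_pow, Matrix.trace_diagonal]

/-! ### Averages, and densities with respect to an arbitrary relation. -/

/-- The average of a real function over all maps from `U` to `V`. -/
def avg {U V : Type} [Finite U] [Finite V] (g : (U → V) → ℝ) : ℝ :=
  letI := Fintype.ofFinite (U → V)
  (∑ ψ, g ψ) / (Nat.card V : ℝ) ^ Nat.card U

section Average

variable {U U' V : Type} [Finite U] [Finite U'] [Finite V]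

theorem avg_eq [h : Fintype (U → V)] (g : (U → V) → ℝ) :
    avg g = (∑ ψ, g ψ) / (Nat.card V : ℝ) ^ Nat.card U := by
  unfold avg
  rw [Subsingleton.elim h (Fintype.ofFinite (U → V))]

theorem avg_equiv (e : U ≃ U') (g : (U' → V) → ℝ) : avg g = avg fun ψ : U → V => g (ψ ∘ e.symm) := by
  let _ := Fintype.ofFinite (U → V)
  let _ := Fintype.ofFinite (U' → V)
  rw [avg_eq, avg_eq, Nat.card_congr e]
  congr 1
  exact (Fintype.sum_equiv (e.arrowCongr (Equiv.refl V)) _ _ fun ψ => rfl).symm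

theorem avg_perm (e : V ≃ V) (g : (U → V) → ℝ) : avg g = avg fun ψ : U → V => g (e ∘ ψ) := by
  let _ := Fintype.ofFinite (U → V)
  rw [avg_eq, avg_eq]
  congr 1
  exact (Fintype.sum_equiv ((Equiv.refl U).arrowCongr e) _ _ fun ψ => rfl).symm

theorem avg_sum (g : (U ⊕ U' → V) → ℝ) :
    avg g = avg fun ψ' : U' → V => avg fun ψ : U → V => g (Sum.elim ψ ψ') := by
  let _ := Fintype.ofFinite (U → V)
  let _ := Fintype.ofFinite (U' → V)
  let _ := Fintype.ofFinite (U ⊕ U' → V)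
  simp only [avg_eq]
  rw [← Finset.sum_div, div_div, Nat.card_sum, pow_add, Finset.sum_comm, ← Fintype.sum_prod_type']
  congr 1
  exact Fintype.sum_equiv (Equiv.sumArrowEquivProdArrow U U' V) _ _ fun ψ => by
    congr 1
    funext x
    rcases x with x | x <;> rfl

theorem avg_mul_left (c : ℝ) (g : (U → V) → ℝ) : avg (fun ψ => c * g ψ) = c * avg g := by
  simp only [avg, ← Finset.mul_sum, mul_div_assoc]

theorem avg_add (g h : (U → V) → ℝ) : avg (fun ψ => g ψ + h ψ) = avg g + avg h := by
  simp only [avg, Finset.sum_add_distrib, add_div]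

theorem avg_const [Nonempty V] (c : ℝ) : avg (fun _ : U → V => c) = c := by
  let _ := Fintype.ofFinite U
  let _ := Fintype.ofFinite V
  rw [avg_eq]
  have : (Nat.card V : ℝ) ≠ 0 := by exact_mod_cast Nat.card_pos.ne'
  simp only [Finset.sum_const, Finset.card_univ, Fintype.card_fun, nsmul_eq_mul]
  simp only [← Nat.card_eq_fintype_card]
  push_cast
  field_simp

end Average

namespace PLGraph

/-- The map `χ` sends the edges of `H` into the relation `r`. -/
def IsHom {X : Type} (r : X → X → Prop) (H : PLGraph) (χ : ℕ ⊕ H.U → X) : Prop :=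
  ∀ a b, H.graph.Adj a b → r (χ a) (χ b)

theorem forall_map_adj {V W X : Type*} (r : X → X → Prop) (G : SimpleGraph V) (f : V → W)
    (hf : Function.Injective f) (χ : W → X) :
    (∀ a b, (G.map f).Adj a b → r (χ a) (χ b)) ↔ ∀ a b, G.Adj a b → r (χ (f a)) (χ (f b)) := by
  constructor
  · exact fun h a b hab => h _ _ (SimpleGraph.map_adj_apply' hab (hf.ne hab.ne))
  · rintro h a b hab
    obtain ⟨_, a, b, hab', rfl, rfl⟩ := (SimpleGraph.map_adj' _ _ _ _).1 hab
    exact h _ _ hab'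

variable {V X : Type} [Finite V] (r : X → X → Prop) (j : V → X) (φ : ℕ → X)

/-- The proportion of the maps from the unlabeled vertices of `H` to `V` that, together with `φ`
on the labeled vertices, send the edges of `H` into the relation `r`. -/
def relDensity (H : PLGraph) : ℝ :=
  avg fun ψ : H.U → V => if IsHom r H (Sum.elim φ (j ∘ ψ)) then 1 else 0

theorem relDensity_congr {H₁ H₂ : PLGraph} (h : Iso H₁ H₂) :
    H₁.relDensity r j φ = H₂.relDensity r j φ := by
  obtain ⟨_, e, he⟩ := h
  unfold relDensity
  rw [avg_equiv e]
  congr 1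
  funext ψ
  refine if_congr ?_ rfl rfl
  have hs : Function.Surjective (Sum.map id e : ℕ ⊕ H₁.U → ℕ ⊕ H₂.U) :=
    Sum.map_surjective.2 ⟨Function.surjective_id, e.surjective⟩
  have key : ∀ a, Sum.elim φ (j ∘ ψ ∘ e.symm) (Sum.map id e a) = Sum.elim φ (j ∘ ψ) a := by
    rintro (a | a) <;> simp
  unfold IsHom
  rw [hs.forall₂]
  simp only [key, he]

theorem isHom_mul_iff {H₁ H₂ : PLGraph} (ψ₁ : H₁.U → X) (ψ₂ : H₂.U → X) :
    IsHom r (mul H₁ H₂) (Sum.elim φ (Sum.elim ψ₁ ψ₂)) ↔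
      IsHom r H₁ (Sum.elim φ ψ₁) ∧ IsHom r H₂ (Sum.elim φ ψ₂) := by
  have i1 : Function.Injective (Sum.map id Sum.inl : ℕ ⊕ H₁.U → ℕ ⊕ (H₁.U ⊕ H₂.U)) :=
    Sum.map_injective.2 ⟨Function.injective_id, Sum.inl_injective⟩
  have i2 : Function.Injective (Sum.map id Sum.inr : ℕ ⊕ H₂.U → ℕ ⊕ (H₁.U ⊕ H₂.U)) :=
    Sum.map_injective.2 ⟨Function.injective_id, Sum.inr_injective⟩
  have k1 : ∀ a, Sum.elim φ (Sum.elim ψ₁ ψ₂) (Sum.map id Sum.inl a) = Sum.elim φ ψ₁ a := by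
    rintro (a | a) <;> rfl
  have k2 : ∀ a, Sum.elim φ (Sum.elim ψ₁ ψ₂) (Sum.map id Sum.inr a) = Sum.elim φ ψ₂ a := by
    rintro (a | a) <;> rfl
  have f1 := forall_map_adj r H₁.graph _ i1 (Sum.elim φ (Sum.elim ψ₁ ψ₂))
  have f2 := forall_map_adj r H₂.graph _ i2 (Sum.elim φ (Sum.elim ψ₁ ψ₂))
  simp only [k1] at f1
  simp only [k2] at f2
  unfold IsHom
  rw [← f1, ← f2]
  constructor
  · exact fun h => ⟨fun a b hab => h a b (Or.inl hab), fun a b hab => h a b (Or.inr hab)⟩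
  · rintro ⟨h1, h2⟩ a b (hab | hab)
    exacts [h1 a b hab, h2 a b hab]

theorem relDensity_mul (H₁ H₂ : PLGraph) :
    (mul H₁ H₂).relDensity r j φ = H₁.relDensity r j φ * H₂.relDensity r j φ := by
  unfold relDensity
  refine (avg_sum (U := H₁.U) (U' := H₂.U) _).trans ?_
  refine Eq.trans ?_ (avg_mul_left _ _)
  refine congrArg avg (funext fun ψ₂ => ?_)
  rw [mul_comm, ← avg_mul_left]
  refine congrArg avg (funext fun ψ₁ => ?_)
  have h := isHom_mul_iff r φ (j ∘ ψ₁) (j ∘ ψ₂)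
  rw [← Sum.comp_elim] at h
  rw [ite_zero_mul_ite_zero, mul_one]
  exact if_congr (h.trans and_comm) rfl rfl

theorem relDensity_of_bot [Nonempty V] (H : PLGraph) (h : H.graph = ⊥) :
    H.relDensity r j φ = 1 := by
  unfold relDensity
  have : ∀ ψ : H.U → V, IsHom r H (Sum.elim φ (j ∘ ψ)) := fun ψ a b hab => by simp [h] at hab
  simp only [this, if_true, avg_const]

/-- Ordinary densities are the case X = V. The general form admits loops, and lets labels sit at
points of X outside V, so that φ can stay fixed while V grows. -/
theorem density_eq_relDensity (H : PLGraph) (G : SimpleGraph V) (φ : ℕ → V) :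
    H.density G φ = H.relDensity G.Adj id φ := by
  let _ := Fintype.ofFinite (H.U → V)
  rw [relDensity, avg_eq, Finset.sum_boole, density, Nat.card_eq_fintype_card,
    Fintype.card_subtype]
  rfl

/-- The assignment that agrees with `ψ` on the labels in `L` outside `T` and with `φ` elsewhere. -/
def override (L : Finset ℕ) (T : Set ℕ) (φ : ℕ → X) (ψ : {l : ℕ // l ∈ L ∧ l ∉ T} → X) (l : ℕ) : X :=
  if h : l ∈ L ∧ l ∉ T then ψ ⟨l, h⟩ else φ l

theorem unlabelMap_injective (H : PLGraph) (T : Set ℕ) : Function.Injective (H.unlabelMap T) := by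
  rintro (a | a) (b | b) hab
  · by_cases ha : a ∈ H.labels ∧ a ∉ T <;> by_cases hb : b ∈ H.labels ∧ b ∉ T <;>
      simp_all [unlabelMap]
  · by_cases ha : a ∈ H.labels ∧ a ∉ T <;> simp_all [unlabelMap]
  · by_cases hb : b ∈ H.labels ∧ b ∉ T <;> simp_all [unlabelMap]
  · simp_all [unlabelMap]

instance (L : Finset ℕ) (T : Set ℕ) : Finite {l : ℕ // l ∈ L ∧ l ∉ T} := finite_unlabeled L T

theorem relDensity_unlabel (T : Set ℕ) (H : PLGraph) :
    (H.unlabel T).relDensity r j φ =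
      avg fun ψ : {l : ℕ // l ∈ H.labels ∧ l ∉ T} → V =>
        H.relDensity r j (override H.labels T φ (j ∘ ψ)) := by
  unfold relDensity
  refine (avg_sum (U := H.U) (U' := {l : ℕ // l ∈ H.labels ∧ l ∉ T}) _).trans ?_
  refine congrArg avg (funext fun ψ' => congrArg avg (funext fun ψ => if_congr ?_ rfl rfl))
  refine (forall_map_adj r H.graph _ (unlabelMap_injective H T) _).trans ?_
  have key : ∀ a, (Sum.elim φ (j ∘ Sum.elim ψ ψ') : ℕ ⊕ (H.unlabel T).U → X) (H.unlabelMap T a) =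
      Sum.elim (override H.labels T φ (j ∘ ψ')) (j ∘ ψ) a := by
    rintro (a | a)
    · by_cases ha : a ∈ H.labels ∧ a ∉ T
      · rw [unlabelMap_of_pos ha]
        exact (dif_pos ha : override H.labels T φ (j ∘ ψ') a = _).symm
      · rw [unlabelMap_of_neg ha]
        exact (dif_neg ha : override H.labels T φ (j ∘ ψ') a = _).symm
    · rfl
  unfold IsHom
  refine forall₂_congr fun a b => imp_congr_right fun _ => ?_
  exact iff_of_eq (congrArg₂ r (key a) (key b))

theorem isHom_congr_labels (H : PLGraph) {φ φ' : ℕ → X} (h : ∀ l ∈ H.labels, φ l = φ' l)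
    (ψ : H.U → X) : IsHom r H (Sum.elim φ ψ) ↔ IsHom r H (Sum.elim φ' ψ) := by
  refine forall₂_congr fun a b => forall_congr' fun hab => ?_
  have key : ∀ a b, H.graph.Adj a b → Sum.elim φ ψ a = Sum.elim φ' ψ a := by
    rintro (a | a) b hab
    · exact h a (H.mem_labels a b hab)
    · rfl
  rw [key a b hab, key b a hab.symm]

theorem isHom_comp (H : PLGraph) (σ : X → X) (hσ : ∀ x y, r (σ x) (σ y) ↔ r x y)
    (ψ : H.U → X) : IsHom r H (Sum.elim (σ ∘ φ) (σ ∘ ψ)) ↔ IsHom r H (Sum.elim φ ψ) := by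
  rw [← Sum.comp_elim]
  exact forall₂_congr fun a b => imp_congr_right fun _ => hσ _ _

/-- Densities are invariant under automorphisms of the relation that preserve V. This is applied to
transpositions of pairs of cells. -/
theorem relDensity_comp (H : PLGraph) (σ : X → X) (hσ : ∀ x y, r (σ x) (σ y) ↔ r x y)
    (e : V ≃ V) (he : ∀ v, j (e v) = σ (j v)) :
    H.relDensity r j (σ ∘ φ) = H.relDensity r j φ := by
  unfold relDensity
  rw [avg_perm e]
  refine congrArg avg (funext fun ψ => if_congr ?_ rfl rfl)
  rw [← isHom_comp r φ H σ hσ]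
  have : j ∘ e ∘ ψ = σ ∘ j ∘ ψ := funext fun u => he _
  rw [this]

end PLGraph

/-! ### Relation densities on the algebra `A`. -/

section RelationDensity

open PLGraph (override)

variable {V X : Type} [Finite V] [Nonempty V] (r : X → X → Prop) (j : V → X) (φ : ℕ → X)

/-- The relation density on isomorphism classes. -/
def PL.relDensity : PL →* ℝ where
  toFun := Quotient.lift (fun H => PLGraph.relDensity r j φ H)
    fun _ _ h => PLGraph.relDensity_congr r j φ h
  map_one' := PLGraph.relDensity_of_bot r j φ PLGraph.empty rfl
  map_mul' := by
    rintro ⟨a⟩ ⟨b⟩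
    exact PLGraph.relDensity_mul r j φ a b

/-- The class in `A` of a partially labeled graph. -/
def toA (H : PLGraph) : A := Ideal.Quotient.mk K (MonoidAlgebra.of ℝ PL (PL.mk H))

/-- The relation density on `A`. -/
def relDensity : A →ₐ[ℝ] ℝ :=
  Ideal.Quotient.liftₐ K (MonoidAlgebra.lift ℝ ℝ PL (PL.relDensity r j φ)) (by
    intro a ha
    have hle : K ≤ RingHom.ker (MonoidAlgebra.lift ℝ ℝ PL (PL.relDensity r j φ)) := by
      refine Ideal.span_le.2 ?_
      rintro _ ⟨F, hF, rfl⟩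
      have : PL.relDensity r j φ F = 1 := by
        rcases hF with rfl | ⟨l, rfl⟩
        · exact PLGraph.relDensity_of_bot r j φ _ rfl
        · exact PLGraph.relDensity_of_bot r j φ _ rfl
      simp [RingHom.mem_ker, this]
    exact hle ha)

theorem relDensity_toA (H : PLGraph) : relDensity r j φ (toA H) = H.relDensity r j φ := by
  change MonoidAlgebra.lift ℝ ℝ PL (PL.relDensity r j φ) (MonoidAlgebra.of ℝ PL (PL.mk H)) = _
  rw [MonoidAlgebra.lift_of]
  rfl

theorem density_toA (G : SimpleGraph V) (φ : ℕ → V) (H : PLGraph) :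
    density G φ (toA H) = H.relDensity G.Adj id φ := by
  rw [← PLGraph.density_eq_relDensity]
  change MonoidAlgebra.lift ℝ ℝ PL (PL.density G φ) (MonoidAlgebra.of ℝ PL (PL.mk H)) = _
  rw [MonoidAlgebra.lift_of]
  rfl

theorem toA_mem_AL (H : PLGraph) : toA H ∈ AL H.labels :=
  ⟨_, Submodule.subset_span ⟨PL.mk H, rfl, rfl⟩, rfl⟩

theorem AL_induction {L : Finset ℕ} {P : ∀ f, f ∈ AL L → Prop}
    (toA : ∀ (H : PLGraph) (h : H.labels = L), P (toA H) (h ▸ toA_mem_AL H))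
    (zero : P 0 (zero_mem _))
    (add : ∀ f g hf hg, P f hf → P g hg → P (f + g) (add_mem hf hg))
    (smul : ∀ (c : ℝ) f hf, P f hf → P (c • f) (Submodule.smul_mem _ c hf))
    {f : A} (hf : f ∈ AL L) : P f hf := by
  suffices h : ∃ h, P f h from h.2
  obtain ⟨x, hx, rfl⟩ := hf
  induction hx using Submodule.span_induction with
  | mem x hx =>
    obtain ⟨⟨H⟩, hF, rfl⟩ := hx
    exact ⟨_, toA H hF⟩
  | zero => rw [map_zero]; exact ⟨_, zero⟩
  | add x y _ _ hx hy => rw [map_add]; exact ⟨_, add _ _ _ _ hx.2 hy.2⟩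
  | smul c x _ hx => rw [map_smul]; exact ⟨_, smul c _ _ hx.2⟩

theorem toA_mul (H₁ H₂ : PLGraph) : toA H₁ * toA H₂ = toA (H₁.mul H₂) := by
  unfold toA
  rw [← map_mul, ← map_mul, PL.mk_mul]

theorem toA_labeledPoint (l : ℕ) : toA (PLGraph.labeledPoint l) = 1 := by
  unfold toA
  rw [← map_one (Ideal.Quotient.mk K), Ideal.Quotient.eq]
  exact Ideal.subset_span ⟨_, Or.inr ⟨l, rfl⟩, rfl⟩

theorem one_mem_AL_empty : (1 : A) ∈ AL ∅ := by
  have h := toA_mem_AL PLGraph.empty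
  have : toA PLGraph.empty = 1 := by
    unfold toA
    rw [← PL.one_eq, map_one, map_one]
  rwa [this] at h

theorem AL_mul {L : Finset ℕ} {f g : A} (hf : f ∈ AL L) (hg : g ∈ AL L) : f * g ∈ AL L := by
  induction hf using AL_induction with
  | toA H hH =>
    induction hg using AL_induction with
    | toA H' hH' =>
      rw [toA_mul]
      convert toA_mem_AL (H.mul H')
      simp [PLGraph.mul, hH, hH']
    | zero => rw [mul_zero]; exact zero_mem _
    | add f g _ _ hf hg => rw [mul_add]; exact add_mem hf hg
    | smul c f _ hf => rw [mul_smul_comm]; exact Submodule.smul_mem _ _ hf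
  | zero => rw [zero_mul]; exact zero_mem _
  | add f g _ _ hf hg => rw [add_mul]; exact add_mem hf hg
  | smul c f _ hf => rw [smul_mul_assoc]; exact Submodule.smul_mem _ _ hf

/-- Missing labels are supplied by isolated labeled vertices, which equal 1 in `A`. -/
theorem AL_mono {L L' : Finset ℕ} (h : L ⊆ L') : AL L ≤ AL L' := by
  induction L' using Finset.strongInduction with
  | H L' ih =>
    by_cases hL : L = L'
    · rw [hL]
    obtain ⟨l, hl, hl'⟩ := Finset.exists_of_ssubset (h.ssubset_of_ne hL)
    refine (ih (L'.erase l) (Finset.erase_ssubset hl)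
      fun x hx => Finset.mem_erase.2 ⟨fun e => hl' (e ▸ hx), h hx⟩).trans ?_
    intro f hf
    induction hf using AL_induction with
    | toA H hH =>
      rw [← mul_one (toA H), ← toA_labeledPoint l, toA_mul]
      convert toA_mem_AL (H.mul (PLGraph.labeledPoint l))
      ext x
      simp only [PLGraph.mul, PLGraph.labeledPoint, hH, Finset.mem_union, Finset.mem_erase,
        Finset.mem_singleton]
      by_cases hx : x = l
      · simp [hx, hl]
      · simp [hx]
    | zero => exact zero_mem _
    | add f g _ _ hf hg => exact add_mem hf hg
    | smul c f _ hf => exact Submodule.smul_mem _ _ hf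

theorem exists_mem_AL (f : A) : ∃ L, f ∈ AL L := by
  obtain ⟨x, rfl⟩ := Ideal.Quotient.mk_surjective f
  induction x using MonoidAlgebra.induction_on with
  | of F =>
    rcases F with ⟨H⟩
    exact ⟨_, toA_mem_AL H⟩
  | add a b ha hb =>
    obtain ⟨L, hL⟩ := ha
    obtain ⟨L', hL'⟩ := hb
    exact ⟨L ∪ L', by
      rw [map_add]
      exact add_mem (AL_mono Finset.subset_union_left hL) (AL_mono Finset.subset_union_right hL')⟩
  | smul c a ha =>
    obtain ⟨L, hL⟩ := ha
    exact ⟨L, Submodule.smul_mem _ c hL⟩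

theorem relDensity_unlabel (T : Set ℕ) {L : Finset ℕ} {f : A} (hf : f ∈ AL L) :
    relDensity r j φ (unlabel T f) =
      avg fun ψ : {l : ℕ // l ∈ L ∧ l ∉ T} → V => relDensity r j (override L T φ (j ∘ ψ)) f := by
  induction hf using AL_induction with
  | toA H hH =>
    subst hH
    have : unlabel T (toA H) = toA (H.unlabel T) := by
      unfold toA
      rw [unlabel_mk, unlabelQG_of]
      rfl
    simp only [this, relDensity_toA, PLGraph.relDensity_unlabel]
  | zero => simp only [map_zero, avg_const]
  | add f g _ _ hf hg => simp only [map_add, avg_add, hf, hg]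
  | smul c f _ hf => simp only [map_smul, smul_eq_mul, avg_mul_left, hf]

theorem relDensity_congr_labels {L : Finset ℕ} {φ φ' : ℕ → X} (h : ∀ l ∈ L, φ l = φ' l) {f : A}
    (hf : f ∈ AL L) : relDensity r j φ f = relDensity r j φ' f := by
  induction hf using AL_induction with
  | toA H hH =>
    subst hH
    simp only [relDensity_toA, PLGraph.relDensity, PLGraph.isHom_congr_labels r H h]
  | zero => simp only [map_zero]
  | add f g _ _ hf hg => simp only [map_add, hf, hg]
  | smul c f _ hf => simp only [map_smul, hf]

theorem relDensity_comp (σ : X → X) (hσ : ∀ x y, r (σ x) (σ y) ↔ r x y)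
    (e : V ≃ V) (he : ∀ v, j (e v) = σ (j v)) (f : A) :
    relDensity r j (σ ∘ φ) f = relDensity r j φ f := by
  obtain ⟨L, hf⟩ := exists_mem_AL f
  induction hf using AL_induction with
  | toA H hH => simp only [relDensity_toA, PLGraph.relDensity_comp r j φ H σ hσ e he]
  | zero => simp only [map_zero]
  | add f g _ _ hf hg => simp only [map_add, hf, hg]
  | smul c f _ hf => simp only [map_smul, hf]

end RelationDensity

/-! ### Interpolation of densities to a real number of pairs. -/

section

open Polynomial Filter

/-- The sequence `s` is eventually given by a rational function, whose value at `μ` is `t`. -/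
def HasValue (μ : ℝ) (s : ℕ → ℝ) (t : ℝ) : Prop :=
  ∃ p q : ℝ[X], q.eval μ ≠ 0 ∧ (∀ᶠ N : ℕ in atTop, s N * q.eval (N : ℝ) = p.eval (N : ℝ)) ∧
    t = p.eval μ / q.eval μ

namespace HasValue

variable {μ : ℝ} {s s' : ℕ → ℝ} {t t' : ℝ}

/-- Two rational functions that agree at all large integers are equal, so the value at μ does not
depend on the representation. -/
theorem unique (h : HasValue μ s t) (h' : HasValue μ s t') : t = t' := by
  obtain ⟨p, q, hq, hs, rfl⟩ := h
  obtain ⟨p', q', hq', hs', rfl⟩ := h'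
  have key : p * q' = p' * q := by
    obtain ⟨N₀, hN⟩ := eventually_atTop.1 (hs.and hs')
    refine Polynomial.eq_of_infinite_eval_eq _ _
      (((Set.Ici_infinite N₀).image (f := fun N : ℕ => (N : ℝ)) Nat.cast_injective.injOn).mono ?_)
    rintro _ ⟨N, hN', rfl⟩
    obtain ⟨h1, h2⟩ := hN N hN'
    simp only [Set.mem_ofPred_eq, eval_mul, ← h1, ← h2]
    ring
  rw [div_eq_div_iff hq hq', ← eval_mul, ← eval_mul, key]

theorem congr (h : HasValue μ s t) (hs : ∀ᶠ N in atTop, s' N = s N) : HasValue μ s' t := by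
  obtain ⟨p, q, hq, hs', rfl⟩ := h
  refine ⟨p, q, hq, ?_, rfl⟩
  filter_upwards [hs, hs'] with N h1 h2
  rw [h1, h2]

theorem const (c : ℝ) : HasValue μ (fun _ => c) c :=
  ⟨C c, 1, by simp, by simp, by simp⟩

theorem natCast : HasValue μ (fun N => (N : ℝ)) μ :=
  ⟨X, 1, by simp, by simp, by simp⟩

theorem add (h : HasValue μ s t) (h' : HasValue μ s' t') :
    HasValue μ (fun N => s N + s' N) (t + t') := by
  obtain ⟨p, q, hq, hs, rfl⟩ := h
  obtain ⟨p', q', hq', hs', rfl⟩ := h'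
  refine ⟨p * q' + p' * q, q * q', by simp [hq, hq'], ?_, ?_⟩
  · filter_upwards [hs, hs'] with N h1 h2
    simp only [eval_add, eval_mul, ← h1, ← h2]
    ring
  · simp only [eval_add, eval_mul]
    field_simp

theorem mul (h : HasValue μ s t) (h' : HasValue μ s' t') :
    HasValue μ (fun N => s N * s' N) (t * t') := by
  obtain ⟨p, q, hq, hs, rfl⟩ := h
  obtain ⟨p', q', hq', hs', rfl⟩ := h'
  refine ⟨p * p', q * q', by simp [hq, hq'], ?_, ?_⟩
  · filter_upwards [hs, hs'] with N h1 h2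
    simp only [eval_mul, ← h1, ← h2]
    ring
  · simp only [eval_mul]
    field_simp

theorem div (h : HasValue μ s t) (h' : HasValue μ s' t') (h0 : t' ≠ 0)
    (hs0 : ∀ᶠ N in atTop, s' N ≠ 0) : HasValue μ (fun N => s N / s' N) (t / t') := by
  obtain ⟨p, q, hq, hs, rfl⟩ := h
  obtain ⟨p', q', hq', hs', rfl⟩ := h'
  have hp' : p'.eval μ ≠ 0 := fun h => h0 (by rw [h, zero_div])
  refine ⟨p * q', q * p', by simp [hq, hp'], ?_, ?_⟩
  · filter_upwards [hs, hs', hs0] with N h1 h2 h3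
    simp only [eval_mul, ← h1, ← h2]
    field_simp
  · simp only [eval_mul]
    field_simp

theorem pow (h : HasValue μ s t) (k : ℕ) : HasValue μ (fun N => s N ^ k) (t ^ k) := by
  induction k with
  | zero => simpa using const 1
  | succ k ih => simpa only [pow_succ] using ih.mul h

theorem sub (h : HasValue μ s t) (h' : HasValue μ s' t') :
    HasValue μ (fun N => s N - s' N) (t - t') := by
  have := h.add ((const (-1)).mul h')
  simpa only [neg_mul, one_mul, ← sub_eq_add_neg] using this

theorem sum {ι : Type*} (J : Finset ι) {s : ι → ℕ → ℝ} {t : ι → ℝ}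
    (h : ∀ i ∈ J, HasValue μ (s i) (t i)) : HasValue μ (fun N => ∑ i ∈ J, s i N) (∑ i ∈ J, t i) := by
  induction J using Finset.induction_on with
  | empty => simpa using const 0
  | insert a J ha ih =>
    simp only [Finset.sum_insert ha]
    exact (h a (Finset.mem_insert_self _ _)).add (ih fun i hi => h i (Finset.mem_insert_of_mem hi))

end HasValue

/-- Cells: those in `C` are single, the others come in pairs, numbered by the natural numbers. -/
abbrev Cell (C : Type) : Type := C ⊕ (ℕ × Bool)

/-- The cells in `C` and in the first `N` pairs. -/
abbrev FinCell (C : Type) (N : ℕ) : Type := C ⊕ (Fin N × Bool)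

namespace Cell

variable {C : Type}

/-- The inclusion of the first cells into all cells. -/
def incl (N : ℕ) : FinCell C N → Cell C := Sum.map id (Prod.map Fin.val id)

/-- The other cell of the pair; the cells in `C` are their own partners. -/
def partner : Cell C → Cell C := Sum.map id (Prod.map id not)

/-- The relation between cells that are partners. -/
def IsPartner (x y : Cell C) : Prop := y = partner x

/-- A permutation of the pairs, as a map of cells. -/
def permute (σ : Equiv.Perm ℕ) : Cell C → Cell C := Sum.map id (Prod.map σ id)

theorem permute_injective (σ : Equiv.Perm ℕ) : Function.Injective (permute σ : Cell C → Cell C) :=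
  Sum.map_injective.2 ⟨Function.injective_id,
    Prod.map_injective.2 ⟨σ.injective, Function.injective_id⟩⟩

theorem isPartner_permute (σ : Equiv.Perm ℕ) (x y : Cell C) :
    IsPartner (permute σ x) (permute σ y) ↔ IsPartner x y := by
  have : partner (permute σ x) = permute σ (partner x) := by
    rcases x with x | ⟨x, d⟩ <;> rfl
  unfold IsPartner
  rw [this, (permute_injective σ).eq_iff]

/-- The transposition of two of the first `N` pairs, on the cells in those pairs. -/
theorem exists_equiv_incl {N p q : ℕ} (hp : p < N) (hq : q < N) :
    ∃ e : FinCell C N ≃ FinCell C N, ∀ v, incl N (e v) = permute (Equiv.swap p q) (incl N v) := by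
  refine ⟨(Equiv.refl C).sumCongr ((Equiv.swap ⟨p, hp⟩ ⟨q, hq⟩).prodCongr (Equiv.refl Bool)), ?_⟩
  rintro (v | ⟨v, d⟩)
  · rfl
  · simp only [incl, permute, Equiv.sumCongr_apply, Sum.map_inr, Equiv.prodCongr_apply, Prod.map_apply,
      Equiv.refl_apply, id]
    congr 2
    simp only [Equiv.swap_apply_def, Fin.ext_iff]
    split_ifs <;> rfl

/-- The pair of a cell. -/
def pairs : Cell C → Finset ℕ
  | Sum.inl _ => ∅
  | Sum.inr x => {x.1}

theorem card_pairs_le (x : Cell C) : (pairs x).card ≤ 1 := by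
  rcases x with x | x <;> simp [pairs]

theorem permute_eq_self {p q : ℕ} {x : Cell C} (hp : p ∉ pairs x) (hq : q ∉ pairs x) :
    permute (Equiv.swap p q) x = x := by
  rcases x with x | ⟨x, d⟩
  · rfl
  · simp only [pairs, Finset.mem_singleton] at hp hq
    simp only [permute, Sum.map_inr, Prod.map_apply, id]
    rw [Equiv.swap_apply_of_ne_of_ne (Ne.symm hp) (Ne.symm hq)]

variable [Fintype C]

/-- All pairs outside J contribute alike, so N enters only through the factor N - |J|, which makes
sense for real N. -/
theorem sum_finCell {N : ℕ} {J : Finset ℕ} {m : ℕ} (hJ : ∀ i ∈ J, i < N) (F : Cell C → ℝ)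
    (hF : ∀ i < N, i ∉ J → ∀ d, F (Sum.inr (i, d)) = F (Sum.inr (m, d))) :
    ∑ v : FinCell C N, F (incl N v) = ∑ c, F (Sum.inl c) + ∑ i ∈ J, ∑ d, F (Sum.inr (i, d)) +
      ((N : ℝ) - J.card) * ∑ d, F (Sum.inr (m, d)) := by
  have hsub : J ⊆ Finset.range N := fun i hi => Finset.mem_range.2 (hJ i hi)
  rw [Fintype.sum_sum_type, Fintype.sum_prod_type, add_assoc]
  congr 1
  refine (Fin.sum_univ_eq_sum_range (fun i => ∑ d, F (Sum.inr (i, d))) N).trans ?_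
  rw [← Finset.sum_sdiff hsub, add_comm]
  congr 1
  rw [Finset.sum_congr rfl (g := fun _ => ∑ d, F (Sum.inr (m, d))), Finset.sum_const,
    Finset.card_sdiff_of_subset hsub, Finset.card_range, nsmul_eq_mul, Nat.cast_sub]
  · simpa using Finset.card_le_card hsub
  · intro i hi
    rw [Finset.mem_sdiff, Finset.mem_range] at hi
    exact Finset.sum_congr rfl fun d _ => hF i hi.1 hi.2 d

/-- The summation over all maps into the first cells, at a real value of the number of pairs. -/
theorem exists_hasValue_sum {μ : ℝ} (k : ℕ) : ∀ (J : Finset ℕ) (G : ℕ → (Fin k → Cell C) → ℝ),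
    (∀ ψ, ∃ t, HasValue μ (fun N => G N ψ) t) →
    (∀ N, ∀ p < N, ∀ q < N, p ∉ J → q ∉ J →
      ∀ ψ, G N (permute (Equiv.swap p q) ∘ ψ) = G N ψ) →
    ∃ t, HasValue μ (fun N => ∑ ψ : Fin k → FinCell C N, G N (incl N ∘ ψ)) t ∧
      ((J.card + k : ℝ) ≤ μ → (∀ ψ t, HasValue μ (fun N => G N ψ) t → 0 ≤ t) → 0 ≤ t) := by
  induction k with
  | zero =>
    intro J G hG _
    obtain ⟨t, ht⟩ := hG Fin.elim0
    refine ⟨t, ht.congr (Eventually.of_forall fun N => ?_), fun _ h => h _ _ ht⟩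
    rw [Fintype.sum_unique]
    congr 1
    exact Subsingleton.elim _ _
  | succ k ih =>
    intro J G hG hinv
    set h : Cell C → ℕ → ℝ := fun x N =>
      ∑ ψ : Fin k → FinCell C N, G N (Fin.cons x (incl N ∘ ψ) : Fin (k + 1) → Cell C) with hh
    have hcons : ∀ (σ : Equiv.Perm ℕ) (x : Cell C) (ψ : Fin k → Cell C),
        permute σ ∘ (Fin.cons x ψ : Fin (k + 1) → Cell C) = Fin.cons (permute σ x) (permute σ ∘ ψ) :=
      fun σ x ψ => Fin.comp_cons _ _ _
    have hx : ∀ x, ∃ t, HasValue μ (h x) t ∧ ((J.card + (k + 1 : ℕ) : ℝ) ≤ μ →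
        (∀ ψ t, HasValue μ (fun N => G N ψ) t → 0 ≤ t) → 0 ≤ t) := by
      intro x
      -- Fixing the first vertex at x distinguishes at most one further pair while one vertex fewer
      -- remains, so the bound |J| + k does not grow.
      obtain ⟨t, ht, hpos⟩ := ih (J ∪ pairs x) (fun N ψ => G N (Fin.cons x ψ : Fin (k + 1) → Cell C))
        (fun ψ => hG _) (fun N p hp q hq hpJ hqJ ψ => by
          rw [Finset.mem_union, not_or] at hpJ hqJ
          rw [← hinv N p hp q hq hpJ.1 hqJ.1 (Fin.cons x ψ), hcons,
            permute_eq_self hpJ.2 hqJ.2])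
      refine ⟨t, ht, fun hle h0 => hpos (le_trans ?_ hle) fun ψ => h0 _⟩
      have h1 := (Finset.card_union_le J (pairs x)).trans (Nat.add_le_add_left (card_pairs_le x) _)
      have h2 : ((J ∪ pairs x).card : ℝ) ≤ J.card + 1 := by exact_mod_cast h1
      push_cast
      linarith
    choose t ht hpos using hx
    -- The pair m represents all pairs outside J.
    obtain ⟨m, hm⟩ := Infinite.exists_notMem_finset J
    refine ⟨∑ c, t (Sum.inl c) + ∑ i ∈ J, ∑ d, t (Sum.inr (i, d)) +
      (μ - J.card) * ∑ d, t (Sum.inr (m, d)), ?_, fun hle h0 => ?_⟩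
    · refine HasValue.congr (((HasValue.sum _ fun c _ => ht (Sum.inl c)).add
        (HasValue.sum J fun i _ => HasValue.sum _ fun d _ => ht (Sum.inr (i, d)))).add
        ((HasValue.natCast.sub (HasValue.const _)).mul
          (HasValue.sum _ fun d _ => ht (Sum.inr (m, d))))) ?_
      filter_upwards [eventually_gt_atTop m, eventually_gt_atTop (J.sup id)] with N hmN hJN
      have hJ : ∀ i ∈ J, i < N := fun i hi => (Finset.le_sup (f := id) hi).trans_lt hJN
      rw [← sum_finCell hJ (fun x => h x N), ← Equiv.sum_comp (Fin.consEquiv fun _ => FinCell C N),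
        Fintype.sum_prod_type]
      · refine Finset.sum_congr rfl fun v _ => Finset.sum_congr rfl fun ψ _ => ?_
        congr 1
        exact Fin.comp_cons _ _ _
      · intro i hi hiJ d
        -- The transposition of i and m fixes J and permutes the first N pairs, so reindexing by it
        -- identifies the two inner sums.
        obtain ⟨e, he⟩ := exists_equiv_incl (C := C) hi hmN
        have hp : (Sum.inr (m, d) : Cell C) = permute (Equiv.swap i m) (Sum.inr (i, d)) := by
          simp [permute]
        simp only [hh, hp]
        symm
        rw [← Equiv.sum_comp ((Equiv.refl (Fin k)).arrowCongr e)]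
        refine Finset.sum_congr rfl fun ψ _ => ?_
        rw [← hinv N i hi m hmN hiJ hm (Fin.cons (Sum.inr (i, d)) (incl N ∘ ψ)), hcons]
        congr 2
        exact funext fun u => he _
    · have h1 : ∀ x, 0 ≤ t x := fun x => hpos x hle h0
      -- The only weight that depends on μ; the lower bound on μ keeps it nonnegative.
      have h2 : 0 ≤ μ - J.card := by
        push_cast at hle
        have : (0 : ℝ) ≤ k := Nat.cast_nonneg k
        linarith
      have := Finset.sum_nonneg fun c (_ : c ∈ Finset.univ) => h1 (Sum.inl c)
      have := Finset.sum_nonneg fun i (_ : i ∈ J) =>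
        Finset.sum_nonneg fun d (_ : d ∈ Finset.univ) => h1 (Sum.inr (i, d))
      have := mul_nonneg h2 (Finset.sum_nonneg fun d (_ : d ∈ Finset.univ) => h1 (Sum.inr (m, d)))
      linarith

/-- The denominators are powers of |C| + 2N, which stay positive at N = μ ≥ 0. -/
theorem exists_hasValue_avg {μ : ℝ} (hμ : 0 ≤ μ) [Nonempty C] {I : Type} [Finite I] (J : Finset ℕ)
    (G : ℕ → (I → Cell C) → ℝ) (hG : ∀ ψ, ∃ t, HasValue μ (fun N => G N ψ) t)
    (hinv : ∀ N, ∀ p < N, ∀ q < N, p ∉ J → q ∉ J →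
      ∀ ψ, G N (permute (Equiv.swap p q) ∘ ψ) = G N ψ) :
    ∃ t, HasValue μ (fun N => avg fun ψ : I → FinCell C N => G N (incl N ∘ ψ)) t ∧
      ((J.card + Nat.card I : ℝ) ≤ μ →
        (∀ ψ t, HasValue μ (fun N => G N ψ) t → 0 ≤ t) → 0 ≤ t) := by
  obtain ⟨t, ht, hpos⟩ := exists_hasValue_sum (μ := μ) (Nat.card I) J
    (fun N ψ => G N (ψ ∘ Finite.equivFin I)) (fun ψ => hG _)
    (fun N p hp q hq hpJ hqJ ψ => hinv N p hp q hq hpJ hqJ _)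
  have hC : (0 : ℝ) < Nat.card C := by exact_mod_cast Nat.card_pos
  have hc : HasValue μ (fun N => (Nat.card (FinCell C N) : ℝ)) (Nat.card C + μ * 2) := by
    refine ((HasValue.const _).add (HasValue.natCast.mul (HasValue.const 2))).congr
      (Eventually.of_forall fun N => ?_)
    rw [Nat.card_sum, Nat.card_prod]
    simp
  have h0 : (0 : ℝ) < Nat.card C + μ * 2 := by positivity
  refine ⟨t / (Nat.card C + μ * 2) ^ Nat.card I, ?_, fun hle h => div_nonneg
    (hpos hle fun ψ t ht => h (ψ ∘ Finite.equivFin I) t ht) (by positivity)⟩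
  refine (ht.div (hc.pow (Nat.card I)) (by positivity) (Eventually.of_forall fun N => ?_)).congr
    (Eventually.of_forall fun N => ?_)
  · have : 0 < Nat.card (FinCell C N) := Nat.card_pos
    positivity
  · rw [avg_equiv (Finite.equivFin I).symm, avg_eq, Nat.card_fin]
    rfl

end Cell

/-! ### Soundness of the calculus at real values of the number of pairs. -/

section PseudoModel

open Cell

variable {C : Type} [Fintype C] [Nonempty C] {μ : ℝ}

/-- The densities with respect to the relation of being partners, in the first cells. -/
abbrev cellDensity (N : ℕ) (φ : ℕ → Cell C) : A →ₐ[ℝ] ℝ := relDensity IsPartner (incl N) φ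

/-- For a single graph the integrand is an indicator independent of N, and it is invariant under
transpositions of pairs that carry no label of the graph. -/
theorem exists_hasValue_cellDensity (hμ : 0 ≤ μ) (φ : ℕ → Cell C) (f : A) :
    ∃ t, HasValue μ (fun N => cellDensity N φ f) t := by
  obtain ⟨L, hf⟩ := exists_mem_AL f
  induction hf using AL_induction with
  | toA H hH =>
    obtain ⟨t, ht, _⟩ := exists_hasValue_avg (C := C) hμ (I := H.U)
      (H.labels.biUnion fun l => pairs (φ l))
      (fun _ ψ => if PLGraph.IsHom IsPartner H (Sum.elim φ ψ) then 1 else 0)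
      (fun ψ => ⟨_, HasValue.const _⟩) (fun N p _ q _ hp hq ψ => by
        refine if_congr ?_ rfl rfl
        rw [← PLGraph.isHom_comp IsPartner φ H _ (isPartner_permute (Equiv.swap p q)) ψ]
        refine PLGraph.isHom_congr_labels _ _ (fun l hl => ?_) _
        rw [Finset.mem_biUnion, not_exists] at hp hq
        exact (permute_eq_self (fun h => hp l ⟨hl, h⟩) (fun h => hq l ⟨hl, h⟩)).symm)
    refine ⟨t, ?_⟩
    simp only [relDensity_toA]
    exact ht
  | zero => exact ⟨0, by simpa only [map_zero] using HasValue.const 0⟩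
  | add f g _ _ hf hg =>
    obtain ⟨t, ht⟩ := hf
    obtain ⟨t', ht'⟩ := hg
    exact ⟨t + t', by simpa only [map_add] using ht.add ht'⟩
  | smul c f _ hf =>
    obtain ⟨t, ht⟩ := hf
    exact ⟨c * t, by simpa only [map_smul, smul_eq_mul] using (HasValue.const c).mul ht⟩

/-- All values of the densities of `f` are nonnegative. -/
def ValueNonneg (C : Type) [Fintype C] [Nonempty C] (μ : ℝ) (f : A) : Prop :=
  ∀ (φ : ℕ → Cell C) (t : ℝ), HasValue μ (fun N => cellDensity N φ f) t → 0 ≤ t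

/-- Unlabeling averages over the removed labels. At most |L| pairs are occupied by labels and at
most |L| labels are averaged, whence the bound 2|L|. -/
theorem ValueNonneg.unlabel {L : Finset ℕ} (hμ : (2 * L.card : ℝ) ≤ μ) {f : A} (hf : f ∈ AL L)
    (T : Set ℕ) (h : ValueNonneg C μ f) : ValueNonneg C μ (unlabel T f) := by
  intro φ t ht
  have hμ0 : 0 ≤ μ := le_trans (by positivity) hμ
  set J := L.biUnion fun l => pairs (φ l) with hJ
  obtain ⟨t', ht', hpos⟩ := exists_hasValue_avg (C := C) hμ0 (I := {l : ℕ // l ∈ L ∧ l ∉ T}) J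
    (fun N ψ => cellDensity N (PLGraph.override L T φ ψ) f)
    (fun ψ => exists_hasValue_cellDensity hμ0 _ _) (fun N p hp q hq hpJ hqJ ψ => by
      obtain ⟨e, he⟩ := exists_equiv_incl (C := C) hp hq
      rw [← relDensity_comp IsPartner (incl N) (PLGraph.override L T φ ψ)
        (permute (Equiv.swap p q)) (isPartner_permute _) e he]
      refine relDensity_congr_labels _ _ (fun l hl => ?_) hf
      -- An averaged label moves with the permutation; any other label of L lies in a single cell or
      -- in a pair of J, which is fixed.
      by_cases hlT : l ∈ L ∧ l ∉ T
      · simp only [PLGraph.override, dif_pos hlT, Function.comp]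
      · simp only [PLGraph.override, dif_neg hlT, Function.comp]
        rw [hJ, Finset.mem_biUnion, not_exists] at hpJ hqJ
        exact (permute_eq_self (fun h => hpJ l ⟨hl, h⟩) (fun h => hqJ l ⟨hl, h⟩)).symm)
  simp only [relDensity_unlabel _ _ _ T hf] at ht
  rw [ht.unique ht']
  refine hpos (le_trans ?_ hμ) fun ψ t ht => h _ t ht
  have h1 : J.card ≤ L.card := by
    simpa using Finset.card_biUnion_le_card_mul L (fun l => pairs (φ l)) 1 fun l _ => card_pairs_le _
  have h2 : Nat.card {l : ℕ // l ∈ L ∧ l ∉ T} ≤ L.card := by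
    exact (Nat.card_le_card_of_injective (fun l : {l : ℕ // l ∈ L ∧ l ∉ T} => (⟨l.1, l.2.1⟩ : L))
      fun a b hab => Subtype.ext (congrArg (fun x : L => (x : ℕ)) hab)).trans_eq (by simp)
  have h3 : (J.card : ℝ) ≤ L.card := by exact_mod_cast h1
  have h4 : (Nat.card {l : ℕ // l ∈ L ∧ l ∉ T} : ℝ) ≤ L.card := by exact_mod_cast h2
  linarith

theorem ValueNonneg.sq (hμ : 0 ≤ μ) (f : A) : ValueNonneg C μ (f ^ 2) := by
  intro φ t ht
  obtain ⟨s, hs⟩ := exists_hasValue_cellDensity hμ φ f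
  simp only [map_pow] at ht
  rw [ht.unique (hs.pow 2)]
  positivity

theorem smul_add_sq {B : Type*} [CommRing B] [Algebra ℝ B] (x : ℝ) (f g : B) :
    (x • f + g) ^ 2 = (x * x) • f ^ 2 + (2 * x) • (f * g) + g ^ 2 := by
  simp only [Algebra.smul_def, map_mul, map_ofNat]
  ring

/-- The usual discriminant argument: for every real x the value of the unlabeled square of x f + g
is nonnegative. -/
theorem ValueNonneg.cauchySchwarz {L : Finset ℕ} (hμ : (2 * L.card : ℝ) ≤ μ) {f g : A}
    (hf : f ∈ AL L) (hg : g ∈ AL L) (T : Set ℕ) :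
    ValueNonneg C μ (QuantumGraph.unlabel T (f ^ 2) * QuantumGraph.unlabel T (g ^ 2) -
      QuantumGraph.unlabel T (f * g) ^ 2) := by
  intro φ t ht
  have hμ0 : 0 ≤ μ := le_trans (by positivity) hμ
  obtain ⟨a, ha⟩ := exists_hasValue_cellDensity hμ0 φ (QuantumGraph.unlabel T (f ^ 2))
  obtain ⟨b, hb⟩ := exists_hasValue_cellDensity hμ0 φ (QuantumGraph.unlabel T (f * g))
  obtain ⟨c, hc⟩ := exists_hasValue_cellDensity hμ0 φ (QuantumGraph.unlabel T (g ^ 2))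
  simp only [map_sub, map_mul, map_pow] at ht
  rw [ht.unique ((ha.mul hc).sub (hb.pow 2))]
  have key : ∀ x : ℝ, 0 ≤ a * (x * x) + 2 * b * x + c := by
    intro x
    have hmem : x • f + g ∈ AL L := add_mem (Submodule.smul_mem _ _ hf) hg
    have hsq : (x • f + g) ^ 2 ∈ AL L := by
      rw [pow_two]
      exact AL_mul hmem hmem
    refine (ValueNonneg.sq hμ0 (x • f + g)).unlabel hμ hsq T φ _ ?_
    have e := smul_add_sq x f g
    simp only [e, map_add, map_smul, smul_eq_mul]
    have := (((HasValue.const (x * x)).mul ha).add ((HasValue.const (2 * x)).mul hb)).add hc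
    convert this using 1
    ring
  have := discrim_le_zero key
  unfold discrim at this
  nlinarith

/-- Soundness, by induction on the derivation. It is essential that k is chosen before C, since the
number of single cells is later taken in terms of k. -/
theorem CSPositive.exists_valueNonneg {f : A} (hf : CSPositive f) :
    ∃ k : ℕ, ∀ (C : Type) [Fintype C] [Nonempty C] (μ : ℝ), k ≤ μ → ValueNonneg C μ f := by
  induction hf with
  | sq f => exact ⟨0, fun C _ _ μ hμ => ValueNonneg.sq (by simpa using hμ) f⟩
  | cauchySchwarz L T _ f g hf hg =>
    exact ⟨2 * L.card, fun C _ _ μ hμ =>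
      ValueNonneg.cauchySchwarz (by push_cast at hμ; exact hμ) hf hg T⟩
  | combination f g α β hα hβ _ _ ihf ihg =>
    obtain ⟨k, hk⟩ := ihf
    obtain ⟨k', hk'⟩ := ihg
    refine ⟨k + k', fun C _ _ μ hμ φ t ht => ?_⟩
    push_cast at hμ
    have h1 : (0 : ℝ) ≤ k := Nat.cast_nonneg k
    have h2 : (0 : ℝ) ≤ k' := Nat.cast_nonneg k'
    have hμ0 : 0 ≤ μ := by linarith
    obtain ⟨a, ha⟩ := exists_hasValue_cellDensity hμ0 φ f
    obtain ⟨b, hb⟩ := exists_hasValue_cellDensity hμ0 φ g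
    simp only [map_add, map_smul, smul_eq_mul] at ht
    rw [ht.unique (((HasValue.const α).mul ha).add ((HasValue.const β).mul hb))]
    have := hk C μ (by linarith) φ a ha
    have := hk' C μ (by linarith) φ b hb
    positivity
  | mul f g _ _ ihf ihg =>
    obtain ⟨k, hk⟩ := ihf
    obtain ⟨k', hk'⟩ := ihg
    refine ⟨k + k', fun C _ _ μ hμ φ t ht => ?_⟩
    push_cast at hμ
    have h1 : (0 : ℝ) ≤ k := Nat.cast_nonneg k
    have h2 : (0 : ℝ) ≤ k' := Nat.cast_nonneg k'
    have hμ0 : 0 ≤ μ := by linarith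
    obtain ⟨a, ha⟩ := exists_hasValue_cellDensity hμ0 φ f
    obtain ⟨b, hb⟩ := exists_hasValue_cellDensity hμ0 φ g
    simp only [map_mul] at ht
    rw [ht.unique (ha.mul hb)]
    exact mul_nonneg (hk C μ (by linarith) φ a ha) (hk' C μ (by linarith) φ b hb)
  | unlabel T f _ ih =>
    obtain ⟨k, hk⟩ := ih
    obtain ⟨L, hL⟩ := exists_mem_AL f
    refine ⟨k + 2 * L.card, fun C _ _ μ hμ => ?_⟩
    push_cast at hμ
    have h1 : (0 : ℝ) ≤ k := Nat.cast_nonneg k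
    have h2 : (0 : ℝ) ≤ L.card := Nat.cast_nonneg _
    exact (hk C μ (by linarith)).unlabel (by linarith) hL T

end PseudoModel

end

/-! ### Cycle densities and the separating quantum graph. -/

/-- The weight g depends on both ends of the path so that the induction can absorb the removed first
edge into it; with g u v = W v u the path closes up to a cycle. -/
theorem sum_mul_prod_path_eq {V : Type*} [Fintype V] [DecidableEq V] (W : Matrix V V ℝ) (n : ℕ) :
    ∀ g : V → V → ℝ, ∑ ψ : Fin (n + 1) → V,
      (∏ i : Fin n, W (ψ i.castSucc) (ψ i.succ)) * g (ψ 0) (ψ (Fin.last n)) =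
        ∑ u, ∑ v, (W ^ n) u v * g u v := by
  induction n with
  | zero =>
    intro g
    rw [← Equiv.sum_comp (Equiv.funUnique (Fin 1) V).symm]
    simp [Matrix.one_apply, ite_mul]
  | succ n ih =>
    intro g
    rw [← Equiv.sum_comp (Fin.consEquiv fun _ => V), Fintype.sum_prod_type]
    refine Finset.sum_congr rfl fun u _ => ?_
    have h := ih fun w v => W u w * g u v
    calc _ = ∑ ψ : Fin (n + 1) → V, (∏ i : Fin n, W (ψ i.castSucc) (ψ i.succ)) *
            (W u (ψ 0) * g u (ψ (Fin.last n))) := by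
          refine Finset.sum_congr rfl fun ψ _ => ?_
          rw [Fin.prod_univ_succ]
          simp only [Fin.consEquiv_apply, Fin.castSucc_zero, Fin.cons_zero, Fin.cons_succ,
            ← Fin.succ_castSucc, ← Fin.succ_last]
          ring
      _ = _ := by
          rw [h, Finset.sum_comm]
          refine Finset.sum_congr rfl fun v _ => ?_
          rw [pow_succ', Matrix.mul_apply, Finset.sum_mul]
          exact Finset.sum_congr rfl fun w _ => by ring

theorem sum_prod_cycle_eq_trace {V : Type*} [Fintype V] [DecidableEq V] (W : Matrix V V ℝ) (n : ℕ) :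
    ∑ ψ : Fin (n + 1) → V, ∏ i, W (ψ i) (ψ (i + 1)) = (W ^ (n + 1)).trace := by
  have h := sum_mul_prod_path_eq W n fun u v => W v u
  rw [pow_succ, Matrix.trace]
  simp only [Matrix.diag_apply, Matrix.mul_apply]
  rw [← h]
  refine Finset.sum_congr rfl fun ψ _ => ?_
  rw [Fin.prod_univ_castSucc, Fin.last_add_one]
  simp only [Fin.coeSucc_eq_succ]

/-- The matrix of a relation. -/
def relMatrix {V : Type*} (r : V → V → Prop) : Matrix V V ℝ :=
  Matrix.of fun u v => if r u v then 1 else 0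

/-- The unlabeled cycle of length `n + 2`; for `n = 0` this is a single edge. -/
def PLGraph.cycle (n : ℕ) : PLGraph where
  labels := ∅
  U := Fin (n + 2)
  finite := inferInstance
  graph := (SimpleGraph.cycleGraph (n + 2)).map Sum.inr
  mem_labels := by
    intro l w h
    obtain ⟨_, a, b, _, ha, _⟩ := (SimpleGraph.map_adj' _ _ _ _).1 h
    simp at ha

/-- Loops of r count like edges. For n = 0 the single edge is traversed twice, which is harmless
because r is symmetric and the entries are 0 or 1. -/
theorem PLGraph.relDensity_cycle {V X : Type} [Fintype V] [DecidableEq V] (r : X → X → Prop)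
    (hr : ∀ x y, r x y → r y x) (j : V → X) (φ : ℕ → X) (n : ℕ) :
    (PLGraph.cycle n).relDensity r j φ =
      (relMatrix (fun u v => r (j u) (j v)) ^ (n + 2)).trace / (Nat.card V : ℝ) ^ (n + 2) := by
  unfold relDensity
  change avg (fun ψ : Fin (n + 2) → V => _) = _
  rw [avg_eq, Nat.card_fin, ← sum_prod_cycle_eq_trace]
  congr 1
  refine Finset.sum_congr rfl fun ψ _ => ?_
  simp only [relMatrix, Matrix.of_apply, Finset.prod_ite_zero, Finset.prod_const_one,
    Finset.mem_univ, true_imp_iff]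
  refine if_congr ((forall_map_adj r (SimpleGraph.cycleGraph (n + 2)) Sum.inr Sum.inr_injective
    _).trans ?_) rfl rfl
  change (∀ a b, (SimpleGraph.cycleGraph (n + 2)).Adj a b → r (j (ψ a)) (j (ψ b))) ↔ _
  constructor
  · exact fun h i => h i (i + 1) (SimpleGraph.cycleGraph_adj.2 (Or.inr (by simp)))
  · intro h a b hab
    rcases SimpleGraph.cycleGraph_adj.1 hab with hab | hab
    · rw [sub_eq_iff_eq_add'.1 hab]
      exact hr _ _ (h b)
    · rw [sub_eq_iff_eq_add'.1 hab]
      exact h a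

/-- A quantum graph in the edge, the triangle, and the cycles of lengths four and six. -/
def cycleWitness : A :=
  let e := toA (PLGraph.cycle 0)
  let m₁ := toA (PLGraph.cycle 1)
  let m₂ := toA (PLGraph.cycle 2)
  let m₄ := toA (PLGraph.cycle 4)
  (1250 : ℝ) • (e ^ 8 * (e * m₄ - m₂ ^ 2)) +
    (e ^ 2 * m₂ ^ 2 - m₁ ^ 2 * e ^ 3 - (1 / 2 : ℝ) • m₂ ^ 3) ^ 2 - (1 / 8 : ℝ) • m₂ ^ 6

theorem AL_empty_pow {f : A} (hf : f ∈ AL ∅) (k : ℕ) : f ^ k ∈ AL ∅ := by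
  induction k with
  | zero => rw [pow_zero]; exact one_mem_AL_empty
  | succ k ih => rw [pow_succ]; exact AL_mul ih hf

theorem cycleWitness_mem : cycleWitness ∈ AL ∅ := by
  have h : ∀ n, toA (PLGraph.cycle n) ∈ AL ∅ := fun n => toA_mem_AL (PLGraph.cycle n)
  have hp : ∀ n k, toA (PLGraph.cycle n) ^ k ∈ AL ∅ := fun n k => AL_empty_pow (h n) k
  refine sub_mem (add_mem (Submodule.smul_mem _ _ (AL_mul (hp _ _)
    (sub_mem (AL_mul (h _) (h _)) (hp _ _)))) (AL_empty_pow (sub_mem (sub_mem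
      (AL_mul (hp _ _) (hp _ _)) (AL_mul (hp _ _) (hp _ _))) (Submodule.smul_mem _ _ (hp _ _))) 2))
    (Submodule.smul_mem _ _ (hp _ _))

theorem positive_cycleWitness : Positive cycleWitness := by
  intro V _ _ G φ
  let _ := Fintype.ofFinite V
  set c : ℝ := (Nat.card V : ℝ)⁻¹ with hc
  have hM : (c • relMatrix G.Adj).IsHermitian := by
    ext u v
    simp [relMatrix, G.adj_comm]
  have h : ∀ n, density G φ (toA (PLGraph.cycle n)) = ∑ i, hM.eigenvalues i ^ (n + 2) := by
    intro n
    rw [density_toA, PLGraph.relDensity_cycle _ (fun _ _ h => h.symm),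
      ← trace_pow_eq_sum_eigenvalues_pow hM, smul_pow, Matrix.trace_smul, smul_eq_mul, hc, inv_pow,
      div_eq_inv_mul]
    rfl
  have := power_sum_inequality hM.eigenvalues rfl rfl rfl rfl
  simpa only [cycleWitness, map_add, map_sub, map_mul, map_pow, map_smul, smul_eq_mul, h] using this

section CellCycles

variable {C : Type}

theorem Cell.isPartner_symm (x y : Cell C) (h : IsPartner x y) : IsPartner y x := by
  unfold IsPartner at *
  subst h
  rcases x with x | ⟨x, d⟩ <;> simp [partner]

/-- The other cell of the pair, among the first cells. -/
def FinCell.partner {N : ℕ} : FinCell C N → FinCell C N := Sum.map id (Prod.map id not)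

theorem FinCell.partner_partner {N : ℕ} (v : FinCell C N) : partner (partner v) = v := by
  rcases v with v | ⟨v, d⟩ <;> simp [partner]

theorem Cell.isPartner_incl {N : ℕ} (u v : FinCell C N) :
    IsPartner (incl N u) (incl N v) ↔ v = FinCell.partner u := by
  rcases u with u | ⟨u, d⟩ <;> rcases v with v | ⟨v, d'⟩ <;>
    simp [IsPartner, incl, partner, FinCell.partner, Fin.ext_iff]

/-- The matrix of the relation of being partners, among the first cells. -/
def partnerMatrix (C : Type) (N : ℕ) : Matrix (FinCell C N) (FinCell C N) ℝ :=
  relMatrix fun u v => Cell.IsPartner (Cell.incl N u) (Cell.incl N v)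

variable [Fintype C]

/-- Passing to the partner is an involution. Hence even cycles count all cells, while the triangle
counts only the fixed ones, those in C. -/
theorem partnerMatrix_sq [DecidableEq C] (N : ℕ) : partnerMatrix C N ^ 2 = 1 := by
  ext u v
  rw [pow_two, Matrix.mul_apply, Finset.sum_eq_single (FinCell.partner u)]
  · simp [partnerMatrix, relMatrix, Cell.isPartner_incl, FinCell.partner_partner,
      Matrix.one_apply, eq_comm]
  · intro w _ hw
    simp [partnerMatrix, relMatrix, Cell.isPartner_incl, hw]
  · simp

theorem trace_partnerMatrix (N : ℕ) : (partnerMatrix C N).trace = Fintype.card C := by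
  rw [Matrix.trace, Fintype.sum_sum_type]
  simp [partnerMatrix, relMatrix, Cell.isPartner_incl, FinCell.partner]

theorem cellDensity_cycle_even [Nonempty C] (N : ℕ) (φ : ℕ → Cell C) (k : ℕ) :
    cellDensity N φ (toA (PLGraph.cycle (2 * k))) =
      (Fintype.card C + N * 2) / (Fintype.card C + N * 2 : ℝ) ^ (2 * k + 2) := by
  rw [relDensity_toA, PLGraph.relDensity_cycle _ Cell.isPartner_symm,
    show 2 * k + 2 = 2 * (k + 1) by ring, pow_mul]
  change ((partnerMatrix C N ^ 2) ^ (k + 1)).trace / _ = _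
  rw [partnerMatrix_sq, one_pow, Matrix.trace_one, Nat.card_eq_fintype_card]
  simp

theorem cellDensity_triangle [Nonempty C] (N : ℕ) (φ : ℕ → Cell C) :
    cellDensity N φ (toA (PLGraph.cycle 1)) =
      Fintype.card C / (Fintype.card C + N * 2 : ℝ) ^ 3 := by
  rw [relDensity_toA, PLGraph.relDensity_cycle _ Cell.isPartner_symm]
  change (partnerMatrix C N ^ (2 + 1)).trace / _ = _
  rw [pow_succ, partnerMatrix_sq, one_mul, trace_partnerMatrix, Nat.card_eq_fintype_card]
  simp

end CellCycles

theorem not_csPositive_cycleWitness : ¬ CSPositive cycleWitness := by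
  intro h
  obtain ⟨k, hk⟩ := h.exists_valueNonneg
  set c : ℝ := k + 2 with hc
  -- The solution of c + 2μ = c^2 + 1/2, which no integer μ satisfies; c = k + 2 makes it at least
  -- k.
  set μ : ℝ := (c ^ 2 - c) / 2 + 1 / 4 with hμ
  have hk0 : (0 : ℝ) ≤ k := Nat.cast_nonneg k
  have hkμ : (k : ℝ) ≤ μ := by nlinarith
  have hcard : ((Fintype.card (Fin (k + 2)) : ℕ) : ℝ) = c := by simp [hc]
  set a : ℝ := c + μ * 2 with ha
  have hac : a = c ^ 2 + 1 / 2 := by rw [ha, hμ]; ring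
  have ha0 : 0 < a := by rw [hac]; positivity
  have hA : HasValue μ (fun N => c + (N : ℝ) * 2) a :=
    (HasValue.const c).add (HasValue.natCast.mul (HasValue.const 2))
  have hne : ∀ m, ∀ᶠ N : ℕ in Filter.atTop, (c + (N : ℝ) * 2) ^ m ≠ 0 :=
    fun m => Filter.Eventually.of_forall fun N => by positivity
  -- The cycles carry no labels, so any assignment serves.
  let φ : ℕ → Cell (Fin (k + 2)) := fun _ => Sum.inl 0
  have heven : ∀ i, HasValue μ (fun N => cellDensity N φ (toA (PLGraph.cycle (2 * i))))
      (a / a ^ (2 * i + 2)) := by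
    intro i
    simp only [cellDensity_cycle_even, hcard]
    exact hA.div (hA.pow _) (by positivity) (hne _)
  have htri : HasValue μ (fun N => cellDensity N φ (toA (PLGraph.cycle 1))) (c / a ^ 3) := by
    simp only [cellDensity_triangle, hcard]
    exact (HasValue.const c).div (hA.pow _) (by positivity) (hne _)
  have he := heven 0
  have h2 := heven 1
  have h4 := heven 2
  have hval := (((HasValue.const 1250).mul ((he.pow 8).mul ((he.mul h4).sub (h2.pow 2)))).add
    (((((he.pow 2).mul (h2.pow 2)).sub ((htri.pow 2).mul (he.pow 3))).sub
      ((HasValue.const (1 / 2)).mul (h2.pow 3))).pow 2)).sub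
    ((HasValue.const (1 / 8)).mul (h2.pow 6))
  have hnn := hk (Fin (k + 2)) μ hkμ φ _ (hval.congr (Filter.Eventually.of_forall fun N => by
    simp only [cycleWitness, map_add, map_sub, map_mul, map_pow, map_smul, smul_eq_mul, Nat.mul_zero,
      Nat.mul_one]))
  have hc2 : c ^ 2 = a - 1 / 2 := by rw [hac]; ring
  -- Up to a positive factor this is a - c^2 - 1/2. With the penalty `h1` also zero, only the
  -- negative term -m₂^6/8 of the witness survives.
  have h0 : (a / a ^ (2 * 0 + 2)) ^ 2 * (a / a ^ (2 * 1 + 2)) ^ 2 -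
      (c / a ^ 3) ^ 2 * (a / a ^ (2 * 0 + 2)) ^ 3 - 1 / 2 * (a / a ^ (2 * 1 + 2)) ^ 3 = 0 := by
    rw [div_pow c, hc2]
    field_simp
    ring
  have h1 : a / a ^ (2 * 0 + 2) * (a / a ^ (2 * 2 + 2)) - (a / a ^ (2 * 1 + 2)) ^ 2 = 0 := by
    field_simp
    ring
  rw [h0, h1] at hnn
  have : 0 < (a / a ^ (2 * 1 + 2)) ^ 6 := by positivity
  linarith

end QuantumGraph

end

theorem mainTheorem3 :
    ∃ f : QuantumGraph.A, f ∈ QuantumGraph.AL ∅ ∧ QuantumGraph.Positive f ∧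
      ¬ QuantumGraph.CSPositive f :=
  ⟨QuantumGraph.cycleWitness, QuantumGraph.cycleWitness_mem, QuantumGraph.positive_cycleWitness,
    QuantumGraph.not_csPositive_cycleWitness⟩
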